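/- Let $p>1$ and $b>0$. For $\beta\ge 0$ and $\alpha>0$ consider, on $I=(0,1)$, the problem $$-(\beta\|u'\|_2^2+1)\,u''=\lambda\,(u^p+u\sin^2u)\ \text{ in } I,\qquad u>0\ \text{ in } I,\qquad u(0)=u(1)=0,\qquad \|u\|_\infty=\alpha, \tag{$P_\beta$}$$ for pairs $(\lambda,u)$ with $\lambda>0$, $u\in C^2([0,1])$, where $\|u'\|_2^2=\int_0^1u'(x)^2dx$. For every $\alpha>0$, $(P_0)$ has exactly one solution pair $(\mu(\alpha),v_\alpha)$, $(P_b)$ has exactly one solution pair $(\lambda(\alpha),u_\alpha)$, and $u_\alpha=v_\alpha$, $$\lambda(\alpha)=(b\|v_\alpha'\|_2^2+1)\,\mu(\alpha).$$ Moreover, as $\alpha\to\infty$, the following hold, with $C_0,\dots,G_4$ defined below. (i) If $p>2$, $$\begin{aligned}\lambda(\alpha)={}&2(p+1)\alpha^{1-p}\Big\{C_0+(C_1+\tfrac12C_{11})\alpha^{1-p}+\tfrac12(C_{12}+C_{21})\alpha^{-p}+\tfrac12C_{22}\alpha^{-(p+1)}+C_2\alpha^{2(1-p)}+o(\alpha^{2(1-p)})\Big\}^2\\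 &\times\Big\{4b\alpha^2\big\{G_0+G_1\alpha^{1-p}+G_2\alpha^{-p}+G_3\alpha^{-(p+1)}+G_4\alpha^{2(1-p)}+o(\alpha^{2(1-p)})\big\}+1\Big\}.\end{aligned}$$ (ii) If $p=2$, $$\begin{aligned}\lambda(\alpha)={}&6\alpha^{-1}\Big\{C_0+(C_1+\tfrac12C_{11})\alpha^{-1}+(\tfrac12C_{12}+\tfrac12C_{21}+C_2+C_3)\alpha^{-2}+o(\alpha^{-2})\Big\}^2\\ &\times\Big\{4b\alpha^2\big\{G_0+G_1\alpha^{-1}+(G_2+G_4)\alpha^{-2}+o(\alpha^{-2})\big\}+1\Big\}.\end{aligned}$$ (iii) If $1<p<2$, $$\begin{aligned}\lambda(\alpha)={}&2(p+1)\alpha^{1-p}\Big\{C_0+(C_1+\tfrac12C_{11})\alpha^{1-p}+C_2\alpha^{2(1-p)}+o(\alpha^{2(1-p)})\Big\}^2\\ &\times\Big\{4b\alpha^2\big\{G_0+G_1\alpha^{1-p}+G_4\alpha^{2(1-p)}+o(\alpha^{2(1-p)})\big\}+1\Big\}.\end{aligned}$$ In particular $\lambda(\alpha)\sim\alpha^{3-p}$;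 precisely, $\lambda(\alpha)/\alpha^{3-p}\to 8b(p+1)C_0^2G_0>0$. The second terms are oscillatory in the sense that their coefficient $C_{11}=C_{11}(\alpha)$ takes both positive and negative values for arbitrarily large $\alpha$. Here, writing $S=S(\theta)=\sin^{2/(p+1)}\theta$, $$\begin{aligned} C_0&=\int_0^1\frac{ds}{\sqrt{1-s^{p+1}}},\qquad C_1=-\frac{p+1}8\int_0^1\frac{1-s^2}{(1-s^{p+1})^{3/2}}ds,\\ C_2&=\frac{3(p+1)^2}{128}\int_0^1\frac{(1-s^2)^2}{(1-s^{p+1})^{5/2}}ds,\\ C_3&=-\frac{3(p+1)^2}{32}\int_0^1\Big(\int_0^s\frac{1-y^2}{(1-y^{p+1})^{5/2}}dy\Big)\cos(2\alpha s)\,ds,\\ C_{11}&=\frac2{p+1}\int_0^{\pi/2}\cos(2\alpha S)\sin^{\frac{3-p}{p+1}}\theta\,d\theta,\\ C_{12}&=\frac{p-1}{2(p+1)}\int_0^{\pi/2}(\sin2\alpha-\sin(2\alpha S))\sin^{\frac{1-p}{p+1}}\theta\,d\theta+\frac{p+1}4\int_0^1\frac{1-s}{(1-s^{p+1})^{3/2}}\sin(2\alpha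 s)\,ds,\\ C_{21}&=-\frac1{p+1}\int_0^{\pi/2}\sin(2\alpha S)\sin^{\frac{3-p}{p+1}}\theta\,d\theta,\\ C_{22}&=\frac{p-1}{4(p+1)}\int_0^{\pi/2}(\cos2\alpha-\cos(2\alpha S))\sin^{\frac{1-p}{p+1}}\theta\,d\theta,\\ E_0&=\int_0^1\sqrt{1-s^{p+1}}\,ds,\qquad E_1=\frac{p+1}8\int_0^1\frac{1-s^2}{\sqrt{1-s^{p+1}}}ds,\\ E_2&=-\frac14\int_0^{\pi/2}(\sin2\alpha-S\sin(2\alpha S))\sin^{\frac{1-p}{p+1}}\theta\,d\theta,\\ E_3&=-\frac18\int_0^{\pi/2}(\cos2\alpha-\cos(2\alpha S))\sin^{\frac{1-p}{p+1}}\theta\,d\theta,\\ E_4&=-\frac{(p+1)^2}{128}\int_0^1\frac{(1-s^2)^2}{(1-s^{p+1})^{3/2}}ds,\\ G_0&=C_0E_0,\qquad G_1=C_0E_1+(C_1+\tfrac12C_{11})E_0,\\ G_2&=\tfrac12(C_{12}+C_{21})E_0+C_0E_2,\qquad G_3=\tfrac12C_{22}E_0+C_0E_3,\\ G_4&=(C_2+C_3)E_0+C_0E_4+(C_1+\tfrac12C_{11})E_1.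 \end{aligned}$$ -/

import Mathlib

open Real Set Filter Topology Asymptotics

noncomputable section

namespace Kirchhoff

/-- The square `‖u'‖₂²` of the `L²(0,1)`-norm of the derivative. -/
def energy (u : ℝ → ℝ) : ℝ := ∫ x in (0 : ℝ)..1, (deriv u x) ^ 2

/-- `(lam, u)` with `lam > 0` and `u ∈ C²([0,1])` is a solution pair of
`-(b‖u'‖₂² + 1) u'' = lam (u^p + u sin² u)`, `u > 0` on `(0,1)`, `u(0) = u(1) = 0`.
Only the values of `u` on `[0,1]` matter. -/
structure IsSolutionPair (b p lam : ℝ) (u : ℝ → ℝ) : Prop where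
  lam_pos : 0 < lam
  contDiffOn : ContDiffOn ℝ 2 u (Icc 0 1)
  eqn : ∀ x ∈ Ioo (0 : ℝ) 1,
    -(b * energy u + 1) * deriv (deriv u) x = lam * (u x ^ p + u x * sin (u x) ^ 2)
  pos : ∀ x ∈ Ioo (0 : ℝ) 1, 0 < u x
  left : u 0 = 0
  right : u 1 = 0

/-- `‖u‖_∞ = α`, the supremum being over `[0,1]`. -/
def HasSupNorm (u : ℝ → ℝ) (α : ℝ) : Prop :=
  IsLUB ((fun x => |u x|) '' Icc (0 : ℝ) 1) α

/-- `(lam, u)` is a solution pair with `‖u‖_∞ = α`, and it is the only one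
(functions being compared on `[0,1]`). -/
def IsUniqueSolutionPair (b p α lam : ℝ) (u : ℝ → ℝ) : Prop :=
  (IsSolutionPair b p lam u ∧ HasSupNorm u α) ∧
    ∀ (l : ℝ) (w : ℝ → ℝ), IsSolutionPair b p l w → HasSupNorm w α →
      l = lam ∧ EqOn w u (Icc 0 1)

def C0 (p : ℝ) : ℝ := ∫ s in (0 : ℝ)..1, 1 / √(1 - s ^ (p + 1))

def C1 (p : ℝ) : ℝ :=
  -((p + 1) / 8) * ∫ s in (0 : ℝ)..1, (1 - s ^ 2) / (1 - s ^ (p + 1)) ^ (3 / 2 : ℝ)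

def C11 (p α : ℝ) : ℝ :=
  2 / (p + 1) * ∫ θ in (0 : ℝ)..(π / 2),
    cos (2 * α * sin θ ^ (2 / (p + 1))) * sin θ ^ ((3 - p) / (p + 1))

def C12 (p α : ℝ) : ℝ :=
  (p - 1) / (2 * (p + 1)) * (∫ θ in (0 : ℝ)..(π / 2),
      (sin (2 * α) - sin (2 * α * sin θ ^ (2 / (p + 1)))) * sin θ ^ ((1 - p) / (p + 1)))
    + (p + 1) / 4 * ∫ s in (0 : ℝ)..1,
      (1 - s) / (1 - s ^ (p + 1)) ^ (3 / 2 : ℝ) * sin (2 * α * s)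

def C21 (p α : ℝ) : ℝ :=
  -(1 / (p + 1)) * ∫ θ in (0 : ℝ)..(π / 2),
    sin (2 * α * sin θ ^ (2 / (p + 1))) * sin θ ^ ((3 - p) / (p + 1))

def C22 (p α : ℝ) : ℝ :=
  (p - 1) / (4 * (p + 1)) * ∫ θ in (0 : ℝ)..(π / 2),
    (cos (2 * α) - cos (2 * α * sin θ ^ (2 / (p + 1)))) * sin θ ^ ((1 - p) / (p + 1))

def C2 (p : ℝ) : ℝ :=
  3 * (p + 1) ^ 2 / 128 *
    ∫ s in (0 : ℝ)..1, (1 - s ^ 2) ^ 2 / (1 - s ^ (p + 1)) ^ (5 / 2 : ℝ)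

def C3 (p α : ℝ) : ℝ :=
  -(3 / 32) * (p + 1) ^ 2 * ∫ s in (0 : ℝ)..1,
    (∫ y in (0 : ℝ)..s, (1 - y ^ 2) / (1 - y ^ (p + 1)) ^ (5 / 2 : ℝ)) * cos (2 * α * s)

def E0 (p : ℝ) : ℝ := ∫ s in (0 : ℝ)..1, √(1 - s ^ (p + 1))

def E1 (p : ℝ) : ℝ :=
  (p + 1) / 8 * ∫ s in (0 : ℝ)..1, (1 - s ^ 2) / √(1 - s ^ (p + 1))

def E2 (p α : ℝ) : ℝ :=
  -(1 / 4) * ∫ θ in (0 : ℝ)..(π / 2),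
    (sin (2 * α) - sin θ ^ (2 / (p + 1)) * sin (2 * α * sin θ ^ (2 / (p + 1))))
      * sin θ ^ ((1 - p) / (p + 1))

def E3 (p α : ℝ) : ℝ :=
  -(1 / 8) * ∫ θ in (0 : ℝ)..(π / 2),
    (cos (2 * α) - cos (2 * α * sin θ ^ (2 / (p + 1)))) * sin θ ^ ((1 - p) / (p + 1))

def E4 (p : ℝ) : ℝ :=
  -((p + 1) ^ 2 / 128) *
    ∫ s in (0 : ℝ)..1, (1 - s ^ 2) ^ 2 / (1 - s ^ (p + 1)) ^ (3 / 2 : ℝ)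

def G0 (p : ℝ) : ℝ := C0 p * E0 p

def G1 (p α : ℝ) : ℝ := C0 p * E1 p + (C1 p + 1 / 2 * C11 p α) * E0 p

def G2 (p α : ℝ) : ℝ := 1 / 2 * (C12 p α + C21 p α) * E0 p + C0 p * E2 p α

def G3 (p α : ℝ) : ℝ := 1 / 2 * C22 p α * E0 p + C0 p * E3 p α

def G4 (p α : ℝ) : ℝ :=
  (C2 p + C3 p α) * E0 p + C0 p * E4 p + (C1 p + 1 / 2 * C11 p α) * E1 p

end Kirchhoff

end

open Kirchhoff

/-! The nonlocal factor `b‖u'‖² + 1` is a number once `u` is fixed, so a solution satisfies `-u'' =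
κ f(u)` with `f(u) = u^p + u sin² u` and `κ = λ / (b‖u'‖² + 1)`. With `F' = f`, conservation of
energy gives `u'² = 2κ (F α - F u)`. Hence the time map `T(y) = ∫₀^y dt / √(F α - F t)` satisfies
`T(u(x)) = √(2κ) x` up to the point of maximum, and the reflected formula holds after it. The
maximum is therefore at `1/2`, `κ = 2 T(α)²`, and `u` is obtained by inverting `T`; none of this
depends on `b`. So `μ = 2 T(α)²`, `u_α = v_α`, and `‖u'‖² = 4 T(α) ∫₀^α √(F α - F y) dy`.

Putting `y = α s` gives `F α - F(α s) = α^{p+1}/(p+1) · (g + d)` with `g = 1 - s^{p+1}` and `0 ≤ d ≤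
C α^{1-p} g` (`pert_le`). Because `d/g` is uniformly small, `1/√(g+d)` and `√(g+d)` can be expanded
to second order in `d` under the integral, with error `O(α^{3(1-p)})/√g`, which is integrable.

The linear term contains, besides `1 - s²`, oscillations of size `1/α`. Against `g^{-3/2}`,
integration by parts (`gapInt_one_sub_eq`) returns a factor `α`, so one of them, `C11`, reaches the
same order as `C1`. In the quadratic term the oscillations tend to `0` by dominated convergence.
`C3` tends to `0` by the Riemann–Lebesgue lemma, so its presence changes only the `o` terms. This
yields one formula for all `p > 1` (`normTime_eq`, `normTime_mul_normVel_eq`); the three regimes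
differ in which powers of `α` are absorbed in the error.

Finally `C11(α) = ∫₀¹ W(s) cos(2αs) ds` with `W = s/√g` increasing and strictly convex. Over whole
periods convexity makes the integral positive (`C11_pos`); an additional initial half period
reverses the sign (`C11_neg`). -/

noncomputable section

namespace Kirchhoff

open MeasureTheory intervalIntegral

/-! ### Time map and existence for the autonomous problem -/

/-- `f` is a continuous function, positive on `(0,∞)`, with antiderivative `F`, and the time map
integrand `1 / √(F α - F y)` is integrable on `(0, α)`. -/
structure IsPotential (f F : ℝ → ℝ) (α : ℝ) : Prop where
  cont : Continuous f
  pos : ∀ u, 0 < u → 0 < f u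
  hasDerivAt : ∀ u, HasDerivAt F (f u) u
  alpha_pos : 0 < α
  integrable : IntervalIntegrable (fun y => 1 / √(F α - F y)) volume 0 α

/-- The integrand of the time map, extended by `1` outside `(0, α)`. -/
def slowness (F : ℝ → ℝ) (α y : ℝ) : ℝ := if y ∈ Ioo 0 α then 1 / √(F α - F y) else 1

/-- The time map, extended to a homeomorphism of the line. -/
def timeMap (F : ℝ → ℝ) (α y : ℝ) : ℝ := ∫ t in (0 : ℝ)..y, slowness F α t

namespace IsPotential

variable {f F : ℝ → ℝ} {α : ℝ}

theorem continuous (h : IsPotential f F α) : Continuous F :=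
  continuous_iff_continuousAt.2 fun u => (h.hasDerivAt u).continuousAt

theorem strictMonoOn (h : IsPotential f F α) : StrictMonoOn F (Ici 0) := by
  refine strictMonoOn_of_deriv_pos (convex_Ici 0) h.continuous.continuousOn fun x hx => ?_
  rw [interior_Ici] at hx
  rw [(h.hasDerivAt x).deriv]
  exact h.pos x hx

theorem sub_pos (h : IsPotential f F α) {y : ℝ} (hy : y ∈ Ioo 0 α) : 0 < F α - F y :=
  _root_.sub_pos.2 (h.strictMonoOn hy.1.le h.alpha_pos.le hy.2)

theorem slowness_pos (h : IsPotential f F α) (y : ℝ) : 0 < slowness F α y := by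
  unfold slowness
  split_ifs with hy
  · have := h.sub_pos hy
    positivity
  · exact one_pos

theorem slowness_integrable (h : IsPotential f F α) (a b : ℝ) :
    IntervalIntegrable (slowness F α) volume a b := by
  have h1 : slowness F α =
      fun y => 1 + (Ioo 0 α).indicator (fun y => 1 / √(F α - F y) - 1) y := by
    funext y
    by_cases hy : y ∈ Ioo 0 α
    · simp [slowness, hy]
    · simp only [slowness, if_neg hy, indicator_of_notMem hy, add_zero]
  rw [h1]
  refine intervalIntegrable_const.add (Integrable.intervalIntegrable ?_)
  rw [integrable_indicator_iff measurableSet_Ioo,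
    ← intervalIntegrable_iff_integrableOn_Ioo_of_le h.alpha_pos.le]
  exact h.integrable.sub intervalIntegrable_const

theorem timeMap_continuous (h : IsPotential f F α) : Continuous (timeMap F α) :=
  continuous_primitive h.slowness_integrable 0

theorem timeMap_strictMono (h : IsPotential f F α) : StrictMono (timeMap F α) := by
  intro y z hyz
  have h1 : timeMap F α z - timeMap F α y = ∫ t in y..z, slowness F α t :=
    integral_interval_sub_left (h.slowness_integrable _ _) (h.slowness_integrable _ _)
  have h2 : 0 < ∫ t in y..z, slowness F α t :=
    intervalIntegral_pos_of_pos_on (h.slowness_integrable _ _) (fun t _ => h.slowness_pos t) hyz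
  linarith

theorem timeMap_of_nonpos (y : ℝ) (hy : y ≤ 0) : timeMap F α y = y := by
  have : timeMap F α y = ∫ t in (0 : ℝ)..y, (1 : ℝ) := by
    refine integral_congr fun t ht => ?_
    rw [uIcc_of_ge hy] at ht
    exact if_neg fun h' => absurd h'.1 (not_lt.2 ht.2)
  simp [this]

theorem timeMap_zero : timeMap F α 0 = 0 := timeMap_of_nonpos 0 le_rfl

theorem timeMap_of_ge (h : IsPotential f F α) (y : ℝ) (hy : α ≤ y) :
    timeMap F α y = timeMap F α α + (y - α) := by
  have h1 : timeMap F α y - timeMap F α α = ∫ t in α..y, slowness F α t :=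
    integral_interval_sub_left (h.slowness_integrable _ _) (h.slowness_integrable _ _)
  have h2 : ∫ t in α..y, slowness F α t = ∫ t in α..y, (1 : ℝ) := by
    refine integral_congr fun t ht => ?_
    rw [uIcc_of_le hy] at ht
    exact if_neg fun h' => absurd h'.2 (not_lt.2 ht.1)
  rw [h2] at h1
  simp at h1
  linarith

theorem timeMap_alpha (h : IsPotential f F α) :
    timeMap F α α = ∫ y in (0 : ℝ)..α, 1 / √(F α - F y) := by
  unfold timeMap
  rw [integral_of_le h.alpha_pos.le, integral_of_le h.alpha_pos.le,
    integral_Ioc_eq_integral_Ioo, integral_Ioc_eq_integral_Ioo]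
  exact setIntegral_congr_fun measurableSet_Ioo fun t ht => if_pos ht

theorem timeMap_alpha_pos (h : IsPotential f F α) : 0 < timeMap F α α := by
  simpa [timeMap_zero] using h.timeMap_strictMono h.alpha_pos

/-- The value `1` of the integrand outside `(0, α)` makes the map a translation on each side, so it
is proper and its inverse exists on the whole line. -/
theorem timeMap_surjective (h : IsPotential f F α) : Function.Surjective (timeMap F α) := by
  refine h.timeMap_continuous.surjective ?_ ?_
  · have : Tendsto (fun y => timeMap F α α + (y - α)) atTop atTop :=
      tendsto_atTop_add_const_left _ _ (tendsto_atTop_add_const_right _ _ tendsto_id)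
    refine this.congr' ?_
    filter_upwards [eventually_ge_atTop α] with y hy
    exact (h.timeMap_of_ge y hy).symm
  · refine tendsto_id.congr' ?_
    filter_upwards [eventually_le_atBot 0] with y hy
    exact (timeMap_of_nonpos y hy).symm

theorem timeMap_hasDerivAt (h : IsPotential f F α) {y : ℝ} (hy : y ∈ Ioo 0 α) :
    HasDerivAt (timeMap F α) (1 / √(F α - F y)) y := by
  have hev : slowness F α =ᶠ[𝓝 y] fun y => 1 / √(F α - F y) := by
    filter_upwards [isOpen_Ioo.mem_nhds hy] with t ht
    exact if_pos ht
  have hc : ContinuousAt (fun y => 1 / √(F α - F y)) y :=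
    continuousAt_const.div ((continuousAt_const.sub h.continuous.continuousAt).sqrt)
      (Real.sqrt_pos.2 (h.sub_pos hy)).ne'
  have hm : AEStronglyMeasurable (slowness F α) (volume.restrict (univ : Set ℝ)) := by
    rw [Measure.restrict_univ]
    refine Measurable.aestronglyMeasurable ?_
    exact Measurable.ite measurableSet_Ioo
      ((measurable_const.sub h.continuous.measurable).sqrt.const_div 1) measurable_const
  have := integral_hasDerivAt_right (h.slowness_integrable 0 y)
    ⟨univ, univ_mem, hm⟩ (hc.congr hev.symm)
  rwa [hev.eq_of_nhds] at this

/-- The order isomorphism of the line given by the time map. -/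
def timeIso (h : IsPotential f F α) : ℝ ≃o ℝ :=
  h.timeMap_strictMono.orderIsoOfSurjective _ h.timeMap_surjective

/-- The profile of the solution with maximum `α`. -/
def profile (h : IsPotential f F α) (x : ℝ) : ℝ :=
  h.timeIso.symm (2 * timeMap F α α * min x (1 - x))

theorem timeMap_profile (h : IsPotential f F α) (x : ℝ) :
    timeMap F α (h.profile x) = 2 * timeMap F α α * min x (1 - x) :=
  h.timeIso.apply_symm_apply _

theorem profile_continuous (h : IsPotential f F α) : Continuous h.profile := by
  unfold profile
  exact h.timeIso.symm.continuous.comp (by fun_prop)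

theorem profile_symm (h : IsPotential f F α) (x : ℝ) : h.profile (1 - x) = h.profile x := by
  unfold profile
  rw [sub_sub_cancel, min_comm]

theorem profile_zero (h : IsPotential f F α) : h.profile 0 = 0 := by
  apply h.timeMap_strictMono.injective
  rw [h.timeMap_profile, timeMap_zero]
  simp

theorem profile_one (h : IsPotential f F α) : h.profile 1 = 0 := by
  have := h.profile_symm 0
  rwa [sub_zero, h.profile_zero] at this

theorem profile_half (h : IsPotential f F α) : h.profile (1 / 2) = α := by
  apply h.timeMap_strictMono.injective
  rw [h.timeMap_profile]
  norm_num
  ring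

theorem profile_pos (h : IsPotential f F α) {x : ℝ} (hx : x ∈ Ioo (0 : ℝ) 1) :
    0 < h.profile x := by
  rw [← h.timeMap_strictMono.lt_iff_lt, timeMap_zero, h.timeMap_profile]
  have : 0 < min x (1 - x) := lt_min hx.1 (by linarith [hx.2])
  have := h.timeMap_alpha_pos
  positivity

theorem profile_le (h : IsPotential f F α) (x : ℝ) : h.profile x ≤ α := by
  rw [← h.timeMap_strictMono.le_iff_le, h.timeMap_profile]
  have h1 : min x (1 - x) ≤ 1 / 2 := by
    rcases le_total x (1 / 2) with h | h
    · exact (min_le_left _ _).trans h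
    · exact (min_le_right _ _).trans (by linarith)
  have := h.timeMap_alpha_pos
  nlinarith

theorem profile_lt (h : IsPotential f F α) {x : ℝ} (hx : x ≠ 1 / 2) : h.profile x < α := by
  rw [← h.timeMap_strictMono.lt_iff_lt, h.timeMap_profile]
  have h1 : min x (1 - x) < 1 / 2 := by
    rcases hx.lt_or_gt with h | h
    · exact (min_le_left _ _).trans_lt h
    · exact (min_le_right _ _).trans_lt (by linarith)
  have := h.timeMap_alpha_pos
  nlinarith

/-- Inverse function rule at an interior value of `(0, α)`. The midpoint is excluded because the
time map has infinite slope on the left of `α`. -/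
theorem profile_hasDerivAt_left (h : IsPotential f F α) {x : ℝ} (hx : x ∈ Ioo (0 : ℝ) (1 / 2)) :
    HasDerivAt h.profile (2 * timeMap F α α * √(F α - F (h.profile x))) x := by
  have hmem : h.profile x ∈ Ioo 0 α :=
    ⟨h.profile_pos ⟨hx.1, by linarith [hx.2]⟩, h.profile_lt hx.2.ne⟩
  have hs : 0 < √(F α - F (h.profile x)) := Real.sqrt_pos.2 (h.sub_pos hmem)
  have hev : h.profile =ᶠ[𝓝 x] fun x => h.timeIso.symm (2 * timeMap F α α * x) := by
    filter_upwards [isOpen_Ioo.mem_nhds hx] with t ht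
    unfold profile
    rw [min_eq_left (by linarith [ht.2])]
  have hx' : h.timeIso.symm (2 * timeMap F α α * x) = h.profile x := hev.eq_of_nhds.symm
  have h1 : HasDerivAt h.timeIso.symm (1 / √(F α - F (h.profile x)))⁻¹
      (2 * timeMap F α α * x) := by
    refine HasDerivAt.of_local_left_inverse (f := timeMap F α)
      h.timeIso.symm.continuous.continuousAt ?_ (by positivity)
      (Eventually.of_forall fun y => h.timeIso.apply_symm_apply y)
    rw [hx']
    exact h.timeMap_hasDerivAt hmem
  have h2 : HasDerivAt (fun x : ℝ => 2 * timeMap F α α * x) (2 * timeMap F α α) x := by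
    simpa using (hasDerivAt_id x).const_mul (2 * timeMap F α α)
  have h3 := (h1.comp x h2).congr_of_eventuallyEq hev
  refine h3.congr_deriv ?_
  rw [one_div, inv_inv, mul_comm]

/-- The derivative of `profile` on `[0,1]`. -/
def slope (h : IsPotential f F α) (x : ℝ) : ℝ :=
  if x ≤ 1 / 2 then 2 * timeMap F α α * √(F α - F (h.profile x))
  else -(2 * timeMap F α α * √(F α - F (h.profile x)))

/-- The second derivative of `profile` on `[0,1]`. -/
def accel (h : IsPotential f F α) (x : ℝ) : ℝ := -(2 * timeMap F α α ^ 2) * f (h.profile x)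

/-- The two branches agree at `1/2` because both vanish there: `profile` equals `α`. -/
theorem slope_continuous (h : IsPotential f F α) : Continuous h.slope := by
  have hc : Continuous fun x => 2 * timeMap F α α * √(F α - F (h.profile x)) :=
    ((continuous_const.sub (h.continuous.comp h.profile_continuous)).sqrt).const_mul _
  refine Continuous.if_le hc hc.neg continuous_id continuous_const ?_
  rintro x rfl
  simp [-one_div, h.profile_half]

theorem accel_continuous (h : IsPotential f F α) : Continuous h.accel :=
  (h.cont.comp h.profile_continuous).const_mul _

theorem slope_symm (h : IsPotential f F α) (x : ℝ) : h.slope (1 - x) = -h.slope x := by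
  unfold slope
  rw [h.profile_symm]
  rcases lt_trichotomy x (1 / 2) with hx | rfl | hx
  · rw [if_neg (by linarith), if_pos hx.le]
  · norm_num [-one_div, h.profile_half]
  · rw [if_pos (by linarith), if_neg (by linarith), neg_neg]

theorem accel_symm (h : IsPotential f F α) (x : ℝ) : h.accel (1 - x) = h.accel x := by
  unfold accel
  rw [h.profile_symm]

/-- Differentiating `√(F α - F u)` produces `-f(u) u' / (2√(F α - F u))`, and the root cancels
against the one in `u'`. -/
theorem slope_hasDerivAt_left (h : IsPotential f F α) {x : ℝ} (hx : x ∈ Ioo (0 : ℝ) (1 / 2)) :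
    HasDerivAt h.slope (h.accel x) x := by
  have hmem : h.profile x ∈ Ioo 0 α :=
    ⟨h.profile_pos ⟨hx.1, by linarith [hx.2]⟩, h.profile_lt hx.2.ne⟩
  have hpos := h.sub_pos hmem
  have hs : 0 < √(F α - F (h.profile x)) := Real.sqrt_pos.2 hpos
  have hev : h.slope =ᶠ[𝓝 x] fun x => 2 * timeMap F α α * √(F α - F (h.profile x)) := by
    filter_upwards [isOpen_Ioo.mem_nhds hx] with t ht
    exact if_pos ht.2.le
  have h1 := (((h.hasDerivAt (h.profile x)).comp x (h.profile_hasDerivAt_left hx)).const_sub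
    (F α)).sqrt hpos.ne'
  refine ((h1.const_mul (2 * timeMap F α α)).congr_of_eventuallyEq hev).congr_deriv ?_
  unfold accel
  simp only [Function.comp_apply]
  field_simp

theorem profile_hasDerivAt (h : IsPotential f F α) {x : ℝ}
    (hx : x ∈ Ioo (0 : ℝ) 1 \ {1 / 2}) : HasDerivAt h.profile (h.slope x) x := by
  rcases (show x ≠ 1 / 2 from hx.2).lt_or_gt with hlt | hgt
  · rw [slope, if_pos hlt.le]
    exact h.profile_hasDerivAt_left ⟨hx.1.1, hlt⟩
  · have h1 := h.profile_hasDerivAt_left (x := 1 - x) ⟨by linarith [hx.1.2], by linarith⟩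
    have h2 := h1.comp x ((hasDerivAt_id x).const_sub 1)
    have h3 : h.profile ∘ (HSub.hSub 1) = h.profile := funext fun t => h.profile_symm t
    rw [h3] at h2
    refine h2.congr_deriv ?_
    rw [slope, if_neg (by linarith), h.profile_symm]
    ring

theorem slope_hasDerivAt (h : IsPotential f F α) {x : ℝ}
    (hx : x ∈ Ioo (0 : ℝ) 1 \ {1 / 2}) : HasDerivAt h.slope (h.accel x) x := by
  rcases (show x ≠ 1 / 2 from hx.2).lt_or_gt with hlt | hgt
  · exact h.slope_hasDerivAt_left ⟨hx.1.1, hlt⟩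
  · have h1 := h.slope_hasDerivAt_left (x := 1 - x) ⟨by linarith [hx.1.2], by linarith⟩
    have h2 := (h1.comp x ((hasDerivAt_id x).const_sub 1)).neg
    have h3 : -(h.slope ∘ (HSub.hSub 1)) = h.slope := by
      funext t
      simp [h.slope_symm]
    rw [h3] at h2
    refine h2.congr_deriv ?_
    rw [h.accel_symm]
    ring

/-- An antiderivative of `accel` on the whole line that agrees with `slope` on `[0,1]`. -/
def slopeExt (h : IsPotential f F α) (x : ℝ) : ℝ := h.slope 0 + ∫ t in (0 : ℝ)..x, h.accel t

/-- The solution: a `C²` function on the whole line that agrees with `profile` on `[0,1]`. -/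
def solution (h : IsPotential f F α) (x : ℝ) : ℝ := ∫ t in (0 : ℝ)..x, h.slopeExt t

theorem slopeExt_hasDerivAt (h : IsPotential f F α) (x : ℝ) :
    HasDerivAt h.slopeExt (h.accel x) x :=
  (integral_hasDerivAt_right (h.accel_continuous.intervalIntegrable _ _)
    (h.accel_continuous.stronglyMeasurableAtFilter _ _)
    h.accel_continuous.continuousAt).const_add _

theorem slopeExt_continuous (h : IsPotential f F α) : Continuous h.slopeExt :=
  continuous_iff_continuousAt.2 fun u => (h.slopeExt_hasDerivAt u).continuousAt

theorem solution_hasDerivAt (h : IsPotential f F α) (x : ℝ) :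
    HasDerivAt h.solution (h.slopeExt x) x :=
  integral_hasDerivAt_right (h.slopeExt_continuous.intervalIntegrable _ _)
    (h.slopeExt_continuous.stronglyMeasurableAtFilter _ _) h.slopeExt_continuous.continuousAt

theorem deriv_solution (h : IsPotential f F α) : deriv h.solution = h.slopeExt :=
  funext fun x => (h.solution_hasDerivAt x).deriv

theorem deriv_slopeExt (h : IsPotential f F α) : deriv h.slopeExt = h.accel :=
  funext fun x => (h.slopeExt_hasDerivAt x).deriv

/-- Integrating the continuous `accel` twice gives smoothness on the line at once, without any
gluing at `1/2` or at the endpoints. -/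
theorem solution_contDiff (h : IsPotential f F α) : ContDiff ℝ 2 h.solution := by
  rw [show (2 : WithTop ℕ∞) = 1 + 1 by norm_num, contDiff_succ_iff_deriv]
  refine ⟨fun x => (h.solution_hasDerivAt x).differentiableAt, by simp, ?_⟩
  rw [h.deriv_solution, contDiff_one_iff_deriv]
  refine ⟨fun x => (h.slopeExt_hasDerivAt x).differentiableAt, ?_⟩
  rw [h.deriv_slopeExt]
  exact h.accel_continuous

/-- The fundamental theorem of calculus tolerates the exceptional point `1/2`: continuity of `slope`
there is enough. -/
theorem slopeExt_eq (h : IsPotential f F α) {x : ℝ} (hx : x ∈ Icc (0 : ℝ) 1) :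
    h.slopeExt x = h.slope x := by
  have := integral_eq_of_hasDerivAt_off_countable h.slope h.accel (countable_singleton (1 / 2))
    (a := 0) (b := x) h.slope_continuous.continuousOn
    (fun t ht => by
      rw [min_eq_left hx.1, max_eq_right hx.1] at ht
      exact h.slope_hasDerivAt ⟨⟨ht.1.1, ht.1.2.trans_le hx.2⟩, ht.2⟩)
    (h.accel_continuous.intervalIntegrable _ _)
  rw [slopeExt, this]
  ring

theorem solution_eq (h : IsPotential f F α) {x : ℝ} (hx : x ∈ Icc (0 : ℝ) 1) :
    h.solution x = h.profile x := by
  have := integral_eq_of_hasDerivAt_off_countable h.profile h.slope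
    (countable_singleton (1 / 2))
    (a := 0) (b := x) h.profile_continuous.continuousOn
    (fun t ht => by
      rw [min_eq_left hx.1, max_eq_right hx.1] at ht
      exact h.profile_hasDerivAt ⟨⟨ht.1.1, ht.1.2.trans_le hx.2⟩, ht.2⟩)
    (h.slope_continuous.intervalIntegrable _ _)
  rw [h.profile_zero, sub_zero] at this
  rw [← this]
  refine integral_congr fun t ht => ?_
  rw [uIcc_of_le hx.1] at ht
  exact h.slopeExt_eq ⟨ht.1, ht.2.trans hx.2⟩

theorem solution_eqn (h : IsPotential f F α) {x : ℝ} (hx : x ∈ Icc (0 : ℝ) 1) :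
    -deriv (deriv h.solution) x = 2 * timeMap F α α ^ 2 * f (h.solution x) := by
  rw [h.deriv_solution, h.deriv_slopeExt, h.solution_eq hx, accel]
  ring

theorem solution_hasSupNorm (h : IsPotential f F α) : HasSupNorm h.solution α := by
  refine IsGreatest.isLUB ⟨⟨1 / 2, by norm_num, ?_⟩, ?_⟩
  · show |h.solution (1 / 2)| = α
    rw [h.solution_eq (by norm_num), h.profile_half, abs_of_pos h.alpha_pos]
  · rintro _ ⟨x, hx, rfl⟩
    show |h.solution x| ≤ α
    rw [h.solution_eq hx, abs_of_nonneg]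
    · exact h.profile_le x
    · rw [← h.timeMap_strictMono.le_iff_le, timeMap_zero, h.timeMap_profile]
      have : 0 ≤ min x (1 - x) := le_min hx.1 (by linarith [hx.2])
      have := h.timeMap_alpha_pos
      positivity

/-- On the left half `u'² dx = 2T √(F α - F u) du`, so a primitive is `2T Q(u)`; symmetry doubles
the result. -/
theorem energy_solution (h : IsPotential f F α) :
    energy h.solution = 4 * timeMap F α α * ∫ y in (0 : ℝ)..α, √(F α - F y) := by
  set T := timeMap F α α
  have hsc : Continuous fun y => √(F α - F y) := (continuous_const.sub h.continuous).sqrt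
  set Q : ℝ → ℝ := fun z => ∫ y in (0 : ℝ)..z, √(F α - F y)
  have hQ : ∀ z, HasDerivAt Q (√(F α - F z)) z := fun z =>
    integral_hasDerivAt_right (hsc.intervalIntegrable _ _)
      (hsc.stronglyMeasurableAtFilter _ _) hsc.continuousAt
  have hQc : Continuous Q := continuous_iff_continuousAt.2 fun u => (hQ u).continuousAt
  have hI : ∀ a b, IntervalIntegrable (fun x => h.slope x ^ 2) volume a b := fun a b =>
    (h.slope_continuous.pow 2).intervalIntegrable _ _
  have h1 : energy h.solution = ∫ x in (0 : ℝ)..1, h.slope x ^ 2 := by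
    refine integral_congr fun x hx => ?_
    rw [uIcc_of_le zero_le_one] at hx
    show deriv h.solution x ^ 2 = _
    rw [h.deriv_solution, h.slopeExt_eq hx]
  have hl : ∫ x in (0 : ℝ)..(1 / 2), h.slope x ^ 2 = 2 * T * Q α := by
    rw [integral_eq_of_hasDerivAt_off_countable (fun x => 2 * T * Q (h.profile x)) _
      countable_empty ((hQc.comp h.profile_continuous).const_mul _).continuousOn ?_ (hI _ _)]
    · simp only [h.profile_half, h.profile_zero]
      simp [Q]
    · intro x hx
      norm_num [-one_div] at hx
      have h2 := ((hQ (h.profile x)).comp x (h.profile_hasDerivAt_left hx)).const_mul (2 * T)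
      refine h2.congr_deriv ?_
      rw [slope, if_pos hx.2.le]
      ring
  have hr : ∫ x in (1 / 2 : ℝ)..1, h.slope x ^ 2 = ∫ x in (0 : ℝ)..(1 / 2), h.slope x ^ 2 := by
    have := integral_comp_sub_left (a := 0) (b := 1 / 2) (fun x => h.slope x ^ 2) 1
    norm_num [-one_div] at this
    rw [← this]
    refine integral_congr fun x _ => ?_
    simp [h.slope_symm]
  rw [h1, ← integral_add_adjacent_intervals (hI 0 (1 / 2)) (hI (1 / 2) 1), hr, hl]
  ring

end IsPotential

/-! ### Uniqueness for the autonomous problem -/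

/-- `w` solves `-w'' = κ f(w)` on `(0,1)` with zero boundary values and maximum `α`; `w₁` is its
derivative. -/
structure IsProfile (f : ℝ → ℝ) (α κ : ℝ) (w w₁ : ℝ → ℝ) : Prop where
  kappa_pos : 0 < κ
  continuousOn : ContinuousOn w (Icc 0 1)
  hasDerivAt : ∀ x ∈ Ioo (0 : ℝ) 1, HasDerivAt w (w₁ x) x
  hasDerivAt₁ : ∀ x ∈ Ioo (0 : ℝ) 1, HasDerivAt w₁ (-(κ * f (w x))) x
  pos : ∀ x ∈ Ioo (0 : ℝ) 1, 0 < w x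
  left : w 0 = 0
  right : w 1 = 0
  le : ∀ x ∈ Icc (0 : ℝ) 1, w x ≤ α

namespace IsProfile

variable {f F : ℝ → ℝ} {α κ : ℝ} {w w₁ : ℝ → ℝ}

theorem reflect (hw : IsProfile f α κ w w₁) :
    IsProfile f α κ (fun x => w (1 - x)) (fun x => -w₁ (1 - x)) where
  kappa_pos := hw.kappa_pos
  continuousOn := hw.continuousOn.comp (by fun_prop)
    fun x hx => ⟨by linarith [hx.2], by linarith [hx.1]⟩
  hasDerivAt x hx := by
    have := (hw.hasDerivAt (1 - x) ⟨by linarith [hx.2], by linarith [hx.1]⟩).comp x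
      ((hasDerivAt_id x).const_sub 1)
    simpa using! this
  hasDerivAt₁ x hx := by
    have := ((hw.hasDerivAt₁ (1 - x) ⟨by linarith [hx.2], by linarith [hx.1]⟩).comp x
      ((hasDerivAt_id x).const_sub 1)).neg
    simpa using! this
  pos x hx := hw.pos _ ⟨by linarith [hx.2], by linarith [hx.1]⟩
  left := by simpa using hw.right
  right := by simpa using hw.left
  le x hx := hw.le _ ⟨by linarith [hx.2], by linarith [hx.1]⟩

/-- Energy conservation makes `timeMap F α ∘ w` have the constant derivative `√(2κ)` before the
maximum. -/
theorem timeMap_eq (hw : IsProfile f α κ w w₁) (h : IsPotential f F α) {c : ℝ}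
    (hc : c ∈ Ioo (0 : ℝ) 1) (hwc : w c = α) {x : ℝ} (hx : x ∈ Icc 0 c) :
    timeMap F α (w x) = √(2 * κ) * x := by
  have hκ := hw.kappa_pos
  have hcrit : w₁ c = 0 := by
    refine IsLocalMax.hasDerivAt_eq_zero ?_ (hw.hasDerivAt c hc)
    filter_upwards [isOpen_Ioo.mem_nhds hc] with t ht
    rw [hwc]
    exact hw.le t ⟨ht.1.le, ht.2.le⟩
  -- Since `w'' < 0` and `w₁ c = 0`, the derivative is positive before `c`. This selects the sign of
  -- the square root in the energy identity.
  have hanti : StrictAntiOn w₁ (Ioo 0 1) := by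
    refine strictAntiOn_of_deriv_neg (convex_Ioo 0 1)
      (fun t ht => (hw.hasDerivAt₁ t ht).continuousAt.continuousWithinAt) fun t ht => ?_
    rw [interior_Ioo] at ht
    rw [(hw.hasDerivAt₁ t ht).deriv]
    have := h.pos _ (hw.pos t ht)
    have := mul_pos hκ this
    linarith
  have hsub : Ioo 0 c ⊆ Ioo (0 : ℝ) 1 := Ioo_subset_Ioo_right hc.2.le
  have hpos : ∀ t ∈ Ioo 0 c, 0 < w₁ t := fun t ht => by
    have := hanti (hsub ht) hc ht.2
    rwa [hcrit] at this
  have hen : ∀ t ∈ Ioo (0 : ℝ) 1, w₁ t ^ 2 = 2 * κ * (F α - F (w t)) := by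
    intro t ht
    have hd : ∀ s ∈ Ioo (0 : ℝ) 1, HasDerivAt (fun s => w₁ s ^ 2 + 2 * κ * F (w s)) 0 s := by
      intro s hs
      have h1 := ((hw.hasDerivAt₁ s hs).pow 2).add
        (((h.hasDerivAt (w s)).comp s (hw.hasDerivAt s hs)).const_mul (2 * κ))
      refine h1.congr_deriv ?_
      ring
    have := isOpen_Ioo.is_const_of_deriv_eq_zero isPreconnected_Ioo
      (fun s hs => (hd s hs).differentiableAt.differentiableWithinAt)
      (fun s hs => (hd s hs).deriv) ht hc
    simp only [hcrit, hwc] at this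
    linarith
  -- If `w t = α` with `t < c`, the energy identity would force `w₁ t = 0`.
  have hmem : ∀ t ∈ Ioo 0 c, w t ∈ Ioo 0 α := by
    intro t ht
    refine ⟨hw.pos t (hsub ht), (hw.le t (Ioo_subset_Icc_self (hsub ht))).lt_of_ne fun he => ?_⟩
    have h1 := hen t (hsub ht)
    rw [he, sub_self, mul_zero] at h1
    have := pow_pos (hpos t ht) 2
    linarith
  have hd : ∀ t ∈ Ioo 0 c,
      HasDerivAt (fun s => timeMap F α (w s)) (√(2 * κ)) t := by
    intro t ht
    refine ((h.timeMap_hasDerivAt (hmem t ht)).comp t (hw.hasDerivAt t (hsub ht))).congr_deriv ?_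
    have h1 : w₁ t = √(2 * κ) * √(F α - F (w t)) := by
      rw [← Real.sqrt_mul (by positivity), ← hen t (hsub ht), Real.sqrt_sq (hpos t ht).le]
    have h2 : 0 < √(F α - F (w t)) := Real.sqrt_pos.2 (h.sub_pos (hmem t ht))
    rw [h1]
    field_simp
  have hcont : ContinuousOn (fun s => timeMap F α (w s)) (uIcc 0 x) := by
    rw [uIcc_of_le hx.1]
    exact h.timeMap_continuous.comp_continuousOn
      (hw.continuousOn.mono (Icc_subset_Icc_right (hx.2.trans hc.2.le)))
  have := integral_eq_of_hasDerivAt_off_countable _ (fun _ => √(2 * κ)) countable_empty hcont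
    (fun t ht => by
      rw [min_eq_left hx.1, max_eq_right hx.1] at ht
      exact hd t ⟨ht.1.1, ht.1.2.trans_le hx.2⟩) intervalIntegrable_const
  rw [intervalIntegral.integral_const, hw.left, IsPotential.timeMap_zero] at this
  simp only [smul_eq_mul] at this
  linarith

/-- The parameter and the profile are determined by the maximum. -/
theorem unique (hw : IsProfile f α κ w w₁) (h : IsPotential f F α)
    (hmax : ∃ c ∈ Icc (0 : ℝ) 1, w c = α) :
    κ = 2 * timeMap F α α ^ 2 ∧ EqOn w h.profile (Icc 0 1) := by
  obtain ⟨c, hcI, hwc⟩ := hmax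
  have hα := h.alpha_pos
  have hc : c ∈ Ioo (0 : ℝ) 1 := by
    refine ⟨hcI.1.lt_of_ne ?_, hcI.2.lt_of_ne ?_⟩
    · rintro rfl
      exact hα.ne (hw.left.symm.trans hwc)
    · rintro rfl
      exact hα.ne (hw.right.symm.trans hwc)
  have hl : ∀ x ∈ Icc 0 c, timeMap F α (w x) = √(2 * κ) * x := fun x hx =>
    hw.timeMap_eq h hc hwc hx
  have hr : ∀ x ∈ Icc c 1, timeMap F α (w x) = √(2 * κ) * (1 - x) := by
    intro x hx
    have := hw.reflect.timeMap_eq h (c := 1 - c) ⟨by linarith [hc.2], by linarith [hc.1]⟩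
      (by simpa using hwc) (x := 1 - x) ⟨by linarith [hx.2], by linarith [hx.1]⟩
    simpa using this
  have hκ : 0 < √(2 * κ) := Real.sqrt_pos.2 (by linarith [hw.kappa_pos])
  -- The formulas from the left and from the right agree at `c`, so `c = 1 - c`.
  have hc2 : c = 1 / 2 := by
    have h1 := hl c ⟨hc.1.le, le_rfl⟩
    rw [hr c ⟨le_rfl, hc.2.le⟩] at h1
    have := mul_left_cancel₀ hκ.ne' h1
    linarith
  have hT : √(2 * κ) = 2 * timeMap F α α := by
    have h1 := hl c ⟨hc.1.le, le_rfl⟩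
    rw [hwc, hc2] at h1
    linarith
  constructor
  · have := Real.sq_sqrt (show (0 : ℝ) ≤ 2 * κ by linarith [hw.kappa_pos])
    rw [hT] at this
    linarith
  · intro x hx
    apply h.timeMap_strictMono.injective
    rw [h.timeMap_profile, ← hT]
    rcases le_total x (1 / 2) with hx2 | hx2
    · rw [min_eq_left (by linarith), hl x ⟨hx.1, hc2 ▸ hx2⟩]
    · rw [min_eq_right (by linarith), hr x ⟨hc2 ▸ hx2, hx.2⟩]

end IsProfile

/-! ### Reduction of the nonlocal problem to the autonomous one -/

theorem energy_nonneg (u : ℝ → ℝ) : 0 ≤ energy u :=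
  integral_nonneg zero_le_one fun _ _ => sq_nonneg _

/-- Only interior derivatives are compared: at `0` and `1`, `deriv` also depends on values outside
`[0,1]`. -/
theorem energy_congr {u v : ℝ → ℝ} (h : EqOn u v (Icc 0 1)) : energy u = energy v := by
  unfold energy
  rw [integral_of_le zero_le_one, integral_of_le zero_le_one, integral_Ioc_eq_integral_Ioo,
    integral_Ioc_eq_integral_Ioo]
  refine setIntegral_congr_fun measurableSet_Ioo fun x hx => ?_
  have : u =ᶠ[𝓝 x] v := by
    filter_upwards [isOpen_Ioo.mem_nhds hx] with t ht
    exact h ⟨ht.1.le, ht.2.le⟩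
  simp only [this.deriv_eq]

/-- The nonlinearity of the problem. -/
def source (p u : ℝ) : ℝ := u ^ p + u * sin u ^ 2

/-- The nonlocal coefficient is a positive constant for the given `w` and can be divided out. -/
theorem IsSolutionPair.isProfile {b p l α : ℝ} {w : ℝ → ℝ} (hb : 0 ≤ b)
    (hw : IsSolutionPair b p l w) (hs : HasSupNorm w α) :
    IsProfile (source p) α (l / (b * energy w + 1)) w (deriv w) := by
  have hE : 0 < b * energy w + 1 := by
    have := mul_nonneg hb (energy_nonneg w)
    linarith
  have hcd : ∀ x ∈ Ioo (0 : ℝ) 1, ContDiffAt ℝ 2 w x := fun x hx =>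
    hw.contDiffOn.contDiffAt (Icc_mem_nhds hx.1 hx.2)
  refine ⟨div_pos hw.lam_pos hE, hw.contDiffOn.continuousOn,
    fun x hx => ((hcd x hx).differentiableAt (by norm_num)).hasDerivAt, fun x hx => ?_, hw.pos,
    hw.left, hw.right, fun x hx => (le_abs_self _).trans (hs.1 ⟨x, hx, rfl⟩)⟩
  have h1 : ContDiffAt ℝ 1 (deriv w) x := by
    exact ((hcd x hx).fderiv_right (m := 1) (by norm_num)).clm_apply contDiffAt_const
  have h2 := (h1.differentiableAt (by norm_num)).hasDerivAt
  have h3 := hw.eqn x hx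
  refine h2.congr_deriv ?_
  unfold source
  field_simp
  linarith

theorem HasSupNorm.exists_eq {p b l α : ℝ} {w : ℝ → ℝ} (hw : IsSolutionPair b p l w)
    (hs : HasSupNorm w α) : ∃ c ∈ Icc (0 : ℝ) 1, w c = α := by
  have hcpt : IsCompact ((fun x => |w x|) '' Icc (0 : ℝ) 1) :=
    isCompact_Icc.image_of_continuousOn hw.contDiffOn.continuousOn.abs
  obtain ⟨c, hc, hca⟩ := hcpt.sSup_mem ((nonempty_Icc.2 zero_le_one).image _)
  have hne : ((fun x => |w x|) '' Icc (0 : ℝ) 1).Nonempty := (nonempty_Icc.2 zero_le_one).image _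
  rw [hs.csSup_eq hne] at hca
  refine ⟨c, hc, ?_⟩
  have : 0 ≤ w c := by
    rcases eq_or_lt_of_le hc.1 with h0 | h0
    · rw [← h0, hw.left]
    rcases eq_or_lt_of_le hc.2 with h1 | h1
    · rw [h1, hw.right]
    exact (hw.pos c ⟨h0, h1⟩).le
  rwa [← abs_of_nonneg this]

/-- Existence and uniqueness of the solution pair with prescribed maximum. -/
theorem IsPotential.isUniqueSolutionPair {b p α : ℝ} {F : ℝ → ℝ}
    (h : IsPotential (source p) F α) (hb : 0 ≤ b) :
    IsUniqueSolutionPair b p α ((b * energy h.solution + 1) * (2 * timeMap F α α ^ 2))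
      h.solution := by
  have hE : ∀ w, 0 < b * energy w + 1 := fun w => by
    have := mul_nonneg hb (energy_nonneg w)
    linarith
  have hT := h.timeMap_alpha_pos
  refine ⟨⟨⟨mul_pos (hE _) (by positivity), h.solution_contDiff.contDiffOn, fun x hx => ?_,
    fun x hx => ?_, ?_, ?_⟩, h.solution_hasSupNorm⟩, fun l w hw hs => ?_⟩
  · have := h.solution_eqn (Ioo_subset_Icc_self hx)
    rw [neg_mul, ← mul_neg, this, source]
    ring
  · rw [h.solution_eq (Ioo_subset_Icc_self hx)]
    exact h.profile_pos hx
  · rw [h.solution_eq (by simp), h.profile_zero]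
  · rw [h.solution_eq (by simp), h.profile_one]
  · obtain ⟨h1, h2⟩ := (hw.isProfile hb hs).unique h (hs.exists_eq hw)
    have h3 : EqOn w h.solution (Icc 0 1) := fun x hx => by rw [h2 hx, h.solution_eq hx]
    refine ⟨?_, h3⟩
    rw [← energy_congr h3, ← h1]
    have := hE w
    field_simp

/-! ### The potential and the estimates for its perturbation -/

/-- The antiderivative of `u sin² u` vanishing at `0`. -/
def sinPot (u : ℝ) : ℝ := u ^ 2 / 4 - u * sin (2 * u) / 4 - cos (2 * u) / 8 + 1 / 8

/-- The antiderivative of the nonlinearity. -/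
def sourcePot (p u : ℝ) : ℝ := u ^ (p + 1) / (p + 1) + sinPot u

theorem sinPot_hasDerivAt (u : ℝ) : HasDerivAt sinPot (u * sin u ^ 2) u := by
  have h2 : HasDerivAt (fun u : ℝ => 2 * u) 2 u := by simpa using (hasDerivAt_id u).const_mul 2
  have hs : HasDerivAt (fun u : ℝ => sin (2 * u)) (cos (2 * u) * 2) u :=
    (Real.hasDerivAt_sin _).comp u h2
  have hc : HasDerivAt (fun u : ℝ => cos (2 * u)) (-sin (2 * u) * 2) u :=
    (Real.hasDerivAt_cos _).comp u h2
  have := (((((hasDerivAt_id u).pow 2).div_const 4).sub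
    (((hasDerivAt_id u).mul hs).div_const 4)).sub (hc.div_const 8)).add_const (1 / 8)
  refine this.congr_deriv ?_
  simp only [id, Real.sin_sq_eq_half_sub]
  push_cast
  ring

theorem sourcePot_hasDerivAt {p : ℝ} (hp : 1 < p) (u : ℝ) :
    HasDerivAt (sourcePot p) (source p u) u := by
  have := ((Real.hasDerivAt_rpow_const (x := u) (p := p + 1) (Or.inr (by linarith))).div_const
    (p + 1)).add (sinPot_hasDerivAt u)
  refine this.congr_deriv ?_
  have : p + 1 ≠ 0 := by linarith
  rw [add_sub_cancel_right, source]
  field_simp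

theorem sinPot_mono {u v : ℝ} (hu : 0 ≤ u) (huv : u ≤ v) : sinPot u ≤ sinPot v := by
  refine monotoneOn_of_deriv_nonneg (convex_Ici 0)
    (fun x _ => (sinPot_hasDerivAt x).continuousAt.continuousWithinAt)
    (fun x _ => (sinPot_hasDerivAt x).differentiableAt.differentiableWithinAt) (fun x hx => ?_)
    (mem_Ici.2 hu) (mem_Ici.2 (hu.trans huv)) huv
  rw [interior_Ici] at hx
  rw [(sinPot_hasDerivAt x).deriv]
  have : (0 : ℝ) < x := hx
  positivity

/-- Integrated form of `u sin² u ≤ u`. Together with `sinPot_mono` it gives a bound on `ripple` that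
is uniform in `α`. -/
theorem sinPot_sub_le {u v : ℝ} (hu : 0 ≤ u) (huv : u ≤ v) :
    sinPot v - sinPot u ≤ (v ^ 2 - u ^ 2) / 2 := by
  have hd : ∀ x : ℝ, HasDerivAt (fun x => x ^ 2 / 2 - sinPot x) (x - x * sin x ^ 2) x := by
    intro x
    have := (((hasDerivAt_id x).pow 2).div_const 2).sub (sinPot_hasDerivAt x)
    refine this.congr_deriv ?_
    simp
  have := monotoneOn_of_deriv_nonneg (convex_Ici 0)
    (fun x _ => (hd x).continuousAt.continuousWithinAt)
    (fun x _ => (hd x).differentiableAt.differentiableWithinAt) (fun x hx => ?_)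
    (mem_Ici.2 hu) (mem_Ici.2 (hu.trans huv)) huv
  · simp only at this
    linarith
  · rw [interior_Ici] at hx
    rw [(hd x).deriv]
    have h0 : (0 : ℝ) < x := hx
    nlinarith [Real.sin_sq_le_one x]

/-- `1 - s^{p+1}`. -/
def gap (p s : ℝ) : ℝ := 1 - s ^ (p + 1)

/-- The normalised contribution of `u sin² u` to the potential difference. -/
def pert (p α s : ℝ) : ℝ := (p + 1) / α ^ (p + 1) * (sinPot α - sinPot (α * s))

/-- The oscillating part of `pert`. -/
def ripple (α s : ℝ) : ℝ :=
  (sin (2 * α) - s * sin (2 * α * s)) / α + (cos (2 * α) - cos (2 * α * s)) / (2 * α ^ 2)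

theorem sourcePot_sub {p α s : ℝ} (hp : 1 < p) (hα : 0 < α) (hs : 0 ≤ s) :
    sourcePot p α - sourcePot p (α * s) = α ^ (p + 1) / (p + 1) * (gap p s + pert p α s) := by
  have h1 : p + 1 ≠ 0 := by linarith
  have h2 : α ^ (p + 1) ≠ 0 := (rpow_pos_of_pos hα _).ne'
  unfold sourcePot gap pert
  rw [mul_rpow hα.le hs]
  field_simp
  ring

theorem rpow_one_sub_eq {p α : ℝ} (hα : 0 < α) : α ^ (1 - p) = α ^ 2 / α ^ (p + 1) := by
  rw [show 1 - p = 2 - (p + 1) by ring, rpow_sub hα]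
  norm_num

theorem pert_eq {p α : ℝ} (hα : 0 < α) (s : ℝ) :
    pert p α s = (p + 1) / 4 * α ^ (1 - p) * ((1 - s ^ 2) - ripple α s) := by
  have h2 : α ^ (p + 1) ≠ 0 := (rpow_pos_of_pos hα _).ne'
  rw [rpow_one_sub_eq hα]
  unfold pert ripple sinPot
  rw [show 2 * (α * s) = 2 * α * s by ring]
  field_simp
  ring

/-- Here `p + 1 ≥ 2`. This is what lets every power of `1 - s²` cancel a power of `gap`. -/
theorem one_sub_sq_le_gap {p s : ℝ} (hp : 1 < p) (hs : s ∈ Icc (0 : ℝ) 1) :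
    1 - s ^ 2 ≤ gap p s := by
  have := Real.rpow_le_rpow_of_exponent_ge' hs.1 hs.2 (by norm_num : (0 : ℝ) ≤ 2)
    (show (2 : ℝ) ≤ p + 1 by linarith)
  rw [rpow_two] at this
  unfold gap
  linarith

theorem one_sub_le_gap {p s : ℝ} (hp : 1 < p) (hs : s ∈ Icc (0 : ℝ) 1) : 1 - s ≤ gap p s := by
  have := one_sub_sq_le_gap hp hs
  nlinarith [hs.1, hs.2]

theorem gap_pos {p s : ℝ} (hp : 1 < p) (hs : s ∈ Ico (0 : ℝ) 1) : 0 < gap p s :=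
  (sub_pos.2 hs.2).trans_le (one_sub_le_gap hp ⟨hs.1, hs.2.le⟩)

theorem gap_le_one {p s : ℝ} (hs : 0 ≤ s) : gap p s ≤ 1 := by
  have := rpow_nonneg hs (p + 1)
  unfold gap
  linarith

theorem pert_nonneg {p α s : ℝ} (hp : 1 < p) (hα : 0 < α) (hs : s ∈ Icc (0 : ℝ) 1) :
    0 ≤ pert p α s := by
  have := sinPot_mono (mul_nonneg hα.le hs.1) (mul_le_of_le_one_right hα.le hs.2)
  have h2 : 0 < α ^ (p + 1) := rpow_pos_of_pos hα _
  exact mul_nonneg (div_nonneg (by linarith) h2.le) (by linarith)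

/-- Up to the factor `α²/4`, the increment of `sinPot` is `(1 - s²) - ripple`, and it lies between
`0` and `2(1 - s²)`. The bound vanishes at `s = 1` and does not depend on `α`, so it serves as a
domination. -/
theorem ripple_abs_le {α s : ℝ} (hα : 0 < α) (hs : s ∈ Icc (0 : ℝ) 1) :
    |ripple α s| ≤ 1 - s ^ 2 := by
  have h1 := sinPot_mono (mul_nonneg hα.le hs.1) (mul_le_of_le_one_right hα.le hs.2)
  have h2 := sinPot_sub_le (mul_nonneg hα.le hs.1) (mul_le_of_le_one_right hα.le hs.2)
  have h3 : sinPot α - sinPot (α * s) = α ^ 2 / 4 * ((1 - s ^ 2) - ripple α s) := by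
    unfold ripple sinPot
    rw [show 2 * (α * s) = 2 * α * s by ring]
    field_simp
    ring
  have hα2 : 0 < α ^ 2 / 4 := by positivity
  have h4 : 0 ≤ α ^ 2 / 4 * ((1 - s ^ 2) - ripple α s) := by linarith
  have h5 : α ^ 2 / 4 * ((1 - s ^ 2) - ripple α s) ≤ α ^ 2 / 4 * (2 * (1 - s ^ 2)) := by
    rw [← h3]
    refine h2.trans (le_of_eq ?_)
    ring
  have h6 := nonneg_of_mul_nonneg_right h4 hα2
  have h7 := le_of_mul_le_mul_left h5 hα2
  rw [abs_le]
  constructor <;> linarith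

/-- The perturbation is small relative to `gap`, uniformly up to the singular endpoint; this
controls every remainder of the expansions. -/
theorem pert_le {p α s : ℝ} (hp : 1 < p) (hα : 0 < α) (hs : s ∈ Icc (0 : ℝ) 1) :
    pert p α s ≤ (p + 1) / 2 * α ^ (1 - p) * gap p s := by
  have h1 := abs_le.1 (ripple_abs_le hα hs)
  have h2 := one_sub_sq_le_gap hp hs
  have h3 : 0 < α ^ (1 - p) := rpow_pos_of_pos hα _
  rw [pert_eq hα]
  have h4 : 0 ≤ (p + 1) / 4 * α ^ (1 - p) := mul_nonneg (by linarith) h3.le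
  have h5 : (1 - s ^ 2) - ripple α s ≤ 2 * gap p s := by linarith
  calc _ ≤ (p + 1) / 4 * α ^ (1 - p) * (2 * gap p s) := mul_le_mul_of_nonneg_left h5 h4
    _ = _ := by ring

theorem measurable_gap (p : ℝ) : Measurable (gap p) := by
  unfold gap
  fun_prop

theorem measurable_pert (p α : ℝ) : Measurable (pert p α) := by
  unfold pert sinPot
  fun_prop

theorem measurable_ripple (α : ℝ) : Measurable (ripple α) := by
  unfold ripple
  fun_prop

theorem intervalIntegrable_one_div_sqrt_one_sub :
    IntervalIntegrable (fun s : ℝ => 1 / √(1 - s)) volume 0 1 := by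
  have h1 : IntervalIntegrable (fun x : ℝ => x ^ (-(1 / 2) : ℝ)) volume 0 1 :=
    intervalIntegrable_rpow' (by norm_num)
  have h2 := (h1.comp_sub_left 1).symm
  simp only [sub_zero, sub_self] at h2
  refine h2.congr fun s hs => ?_
  rw [uIoc_of_le zero_le_one] at hs
  rw [rpow_neg (by linarith [hs.2]), ← Real.sqrt_eq_rpow, one_div]

/-- A function on `(0,1)` with at most an inverse square root singularity at `1` is integrable. -/
theorem intervalIntegrable_of_abs_le {φ : ℝ → ℝ} {C : ℝ}
    (hm : AEStronglyMeasurable φ (volume.restrict (Ioo 0 1)))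
    (hb : ∀ s ∈ Ioo (0 : ℝ) 1, |φ s| ≤ C * (1 / √(1 - s))) :
    IntervalIntegrable φ volume 0 1 := by
  have hC := intervalIntegrable_one_div_sqrt_one_sub.const_mul C
  rw [intervalIntegrable_iff_integrableOn_Ioo_of_le zero_le_one] at hC ⊢
  exact Integrable.mono' hC hm ((ae_restrict_mem measurableSet_Ioo).mono fun s hs => hb s hs)

/-! ### Scaling to the unit interval -/

/-- The normalised time map. -/
def normTime (p α : ℝ) : ℝ := ∫ s in (0 : ℝ)..1, 1 / √(gap p s + pert p α s)

/-- The normalised integral of the velocity. -/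
def normVel (p α : ℝ) : ℝ := ∫ s in (0 : ℝ)..1, √(gap p s + pert p α s)

theorem isPotential {p α : ℝ} (hp : 1 < p) (hα : 0 < α) :
    IsPotential (source p) (sourcePot p) α where
  cont := by
    unfold source
    have : Continuous fun u : ℝ => u ^ p := Real.continuous_rpow_const (by linarith)
    fun_prop
  pos u hu := by
    have := rpow_pos_of_pos hu p
    unfold source
    positivity
  hasDerivAt := sourcePot_hasDerivAt hp
  alpha_pos := hα
  integrable := by
    have hk : 0 < α ^ (p + 1) / (p + 1) := div_pos (rpow_pos_of_pos hα _) (by linarith)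
    have h1 : IntervalIntegrable
        (fun s => 1 / √(sourcePot p α - sourcePot p (α * s))) volume 0 1 := by
      have hc : Continuous (sourcePot p) :=
        continuous_iff_continuousAt.2 fun u => (sourcePot_hasDerivAt hp u).continuousAt
      refine intervalIntegrable_of_abs_le (C := 1 / √(α ^ (p + 1) / (p + 1)))
        (Measurable.aestronglyMeasurable ?_) fun s hs => ?_
      · exact (continuous_const.sub
          (hc.comp (continuous_const.mul continuous_id))).sqrt.measurable.const_div 1
      · rw [sourcePot_sub hp hα hs.1.le, Real.sqrt_mul hk.le, abs_of_nonneg (by positivity),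
          ← one_div_mul_one_div]
        have h2 : 1 - s ≤ gap p s + pert p α s := by
          have := one_sub_le_gap hp (Ioo_subset_Icc_self hs)
          have := pert_nonneg hp hα (Ioo_subset_Icc_self hs)
          linarith
        have h3 : 0 < √(1 - s) := Real.sqrt_pos.2 (by linarith [hs.2])
        gcongr
    -- Integrability is known in the variable `s = y/α`; this transports it back to `(0, α)`.
    have h2 := h1.comp_mul_left (c := α⁻¹)
    simp only [zero_div, one_div, inv_inv] at h2
    refine (h2.congr fun s _ => ?_)
    simp only [one_div]
    rw [mul_inv_cancel_left₀ hα.ne']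

theorem timeMap_sourcePot {p α : ℝ} (hp : 1 < p) (hα : 0 < α) :
    timeMap (sourcePot p) α α = α * (1 / √(α ^ (p + 1) / (p + 1)) * normTime p α) := by
  have hk : 0 < α ^ (p + 1) / (p + 1) := div_pos (rpow_pos_of_pos hα _) (by linarith)
  rw [(isPotential hp hα).timeMap_alpha]
  have := mul_integral_comp_mul_left (a := 0) (b := 1)
    (f := fun y => 1 / √(sourcePot p α - sourcePot p y)) (c := α)
  rw [mul_zero, mul_one] at this
  rw [← this]
  congr 1
  rw [normTime, ← intervalIntegral.integral_const_mul]
  refine integral_congr fun s hs => ?_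
  rw [uIcc_of_le zero_le_one] at hs
  rw [sourcePot_sub hp hα hs.1, Real.sqrt_mul hk.le, one_div_mul_one_div]

theorem timeMap_eq_normTime {p α : ℝ} (hp : 1 < p) (hα : 0 < α) :
    2 * timeMap (sourcePot p) α α ^ 2 = 2 * (p + 1) * α ^ (1 - p) * normTime p α ^ 2 := by
  have hk : 0 < α ^ (p + 1) / (p + 1) := div_pos (rpow_pos_of_pos hα _) (by linarith)
  have h1 := timeMap_sourcePot hp hα
  rw [h1, mul_pow, mul_pow, div_pow, Real.sq_sqrt hk.le, rpow_one_sub_eq hα]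
  have : p + 1 ≠ 0 := by linarith
  have : α ^ (p + 1) ≠ 0 := (rpow_pos_of_pos hα _).ne'
  field_simp

/-- The factor `√(α^{p+1}/(p+1))` of the velocity integral cancels its inverse in the time map,
leaving only `α²`. -/
theorem energy_eq_normVel {p α : ℝ} (hp : 1 < p) (hα : 0 < α) :
    energy (isPotential hp hα).solution = 4 * α ^ 2 * (normTime p α * normVel p α) := by
  have hk : 0 < α ^ (p + 1) / (p + 1) := div_pos (rpow_pos_of_pos hα _) (by linarith)
  have h1 := timeMap_sourcePot hp hα
  have h2 : ∫ y in (0 : ℝ)..α, √(sourcePot p α - sourcePot p y) =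
      α * (√(α ^ (p + 1) / (p + 1)) * normVel p α) := by
    have := mul_integral_comp_mul_left (a := 0) (b := 1)
      (f := fun y => √(sourcePot p α - sourcePot p y)) (c := α)
    rw [mul_zero, mul_one] at this
    rw [← this]
    congr 1
    rw [normVel, ← intervalIntegral.integral_const_mul]
    refine integral_congr fun s hs => ?_
    rw [uIcc_of_le zero_le_one] at hs
    rw [sourcePot_sub hp hα hs.1, Real.sqrt_mul hk.le]
  rw [IsPotential.energy_solution, h1, h2]
  have := Real.sqrt_pos.2 hk
  field_simp

/-! ### Integrals with singular weights `(1 - s^{p+1})^{-n-1/2}` -/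

theorem integral_congr_Ioo {f g : ℝ → ℝ} {a b : ℝ} (hab : a ≤ b)
    (h : ∀ s ∈ Ioo a b, f s = g s) :
    ∫ s in a..b, f s = ∫ s in a..b, g s := by
  rw [integral_of_le hab, integral_of_le hab, integral_Ioc_eq_integral_Ioo,
    integral_Ioc_eq_integral_Ioo]
  exact setIntegral_congr_fun measurableSet_Ioo h

/-- `∫₀¹ φ(s) (1 - s^{p+1})^{-n-1/2} ds`. -/
def gapInt (p : ℝ) (n : ℕ) (φ : ℝ → ℝ) : ℝ :=
  ∫ s in (0 : ℝ)..1, φ s / (gap p s ^ n * √(gap p s))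

/-- `φ` is measurable and `O((1 - s^{p+1})^n)` on `(0,1)`. -/
def GapBounded (p : ℝ) (n : ℕ) (φ : ℝ → ℝ) : Prop :=
  Measurable φ ∧ ∃ C, ∀ s ∈ Ioo (0 : ℝ) 1, |φ s| ≤ C * gap p s ^ n

theorem gapInt_congr {p : ℝ} {n : ℕ} {φ ψ : ℝ → ℝ} (h : ∀ s ∈ Ioo (0 : ℝ) 1, φ s = ψ s) :
    gapInt p n φ = gapInt p n ψ :=
  integral_congr_Ioo zero_le_one fun s hs => by rw [h s hs]

theorem sqrt_gap_pos {p s : ℝ} (hp : 1 < p) (hs : s ∈ Ioo (0 : ℝ) 1) : 0 < √(gap p s) :=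
  Real.sqrt_pos.2 (gap_pos hp ⟨hs.1.le, hs.2⟩)

/-- A numerator of order `gap ^ n` leaves only the integrable singularity `1/√gap`, whatever `n` is.
-/
theorem abs_div_gap_le {p C x : ℝ} {n : ℕ} (hp : 1 < p) {s : ℝ} (hs : s ∈ Ioo (0 : ℝ) 1)
    (hb : |x| ≤ C * gap p s ^ n) :
    |x / (gap p s ^ n * √(gap p s))| ≤ C * (1 / √(gap p s)) := by
  have h1 := gap_pos hp ⟨hs.1.le, hs.2⟩
  have h2 := sqrt_gap_pos hp hs
  rw [abs_div, abs_of_pos (by positivity : 0 < gap p s ^ n * √(gap p s)),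
    div_le_iff₀ (by positivity)]
  refine hb.trans (le_of_eq ?_)
  field_simp

theorem GapBounded.intervalIntegrable {p : ℝ} {n : ℕ} {φ : ℝ → ℝ} (hp : 1 < p)
    (h : GapBounded p n φ) :
    IntervalIntegrable (fun s => φ s / (gap p s ^ n * √(gap p s))) volume 0 1 := by
  obtain ⟨hm, C, hC⟩ := h
  have hg := measurable_gap p
  refine intervalIntegrable_of_abs_le (C := |C|)
    (Measurable.aestronglyMeasurable (by fun_prop)) fun s hs => ?_
  refine (abs_div_gap_le hp hs (hC s hs)).trans ?_
  have h3 : 0 < √(1 - s) := Real.sqrt_pos.2 (by linarith [hs.2])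
  have h4 := one_sub_le_gap hp (Ioo_subset_Icc_self hs)
  calc C * (1 / √(gap p s)) ≤ |C| * (1 / √(gap p s)) :=
        mul_le_mul_of_nonneg_right (le_abs_self C) (by positivity)
    _ ≤ _ := by gcongr

namespace GapBounded

variable {p : ℝ} {n m : ℕ} {φ ψ : ℝ → ℝ}

theorem const_mul (h : GapBounded p n φ) (c : ℝ) : GapBounded p n fun s => c * φ s := by
  obtain ⟨hm, C, hC⟩ := h
  refine ⟨hm.const_mul c, |c| * C, fun s hs => ?_⟩
  rw [abs_mul, mul_assoc]
  exact mul_le_mul_of_nonneg_left (hC s hs) (abs_nonneg c)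

theorem add (h : GapBounded p n φ) (h' : GapBounded p n ψ) :
    GapBounded p n fun s => φ s + ψ s := by
  obtain ⟨hm, C, hC⟩ := h
  obtain ⟨hm', C', hC'⟩ := h'
  refine ⟨hm.add hm', C + C', fun s hs => ?_⟩
  rw [add_mul]
  exact (abs_add_le _ _).trans (add_le_add (hC s hs) (hC' s hs))

theorem sub (h : GapBounded p n φ) (h' : GapBounded p n ψ) :
    GapBounded p n fun s => φ s - ψ s := by
  have := h.add (h'.const_mul (-1))
  simpa [sub_eq_add_neg] using this

theorem mul (h : GapBounded p n φ) (h' : GapBounded p m ψ) :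
    GapBounded p (n + m) fun s => φ s * ψ s := by
  obtain ⟨hm, C, hC⟩ := h
  obtain ⟨hm', C', hC'⟩ := h'
  refine ⟨hm.mul hm', C * C', fun s hs => ?_⟩
  rw [abs_mul, pow_add, mul_mul_mul_comm]
  exact mul_le_mul (hC s hs) (hC' s hs) (abs_nonneg _) ((abs_nonneg _).trans (hC s hs))

theorem sq (h : GapBounded p n φ) : GapBounded p (n + n) fun s => φ s ^ 2 := by
  simpa [pow_two] using h.mul h

theorem zero_of_le (hp : 1 < p) (h : GapBounded p n φ) : GapBounded p 0 φ := by
  obtain ⟨hm, C, hC⟩ := h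
  refine ⟨hm, |C|, fun s hs => (hC s hs).trans ?_⟩
  have h1 := gap_pos hp ⟨hs.1.le, hs.2⟩
  have h2 : gap p s ^ n ≤ 1 := pow_le_one₀ h1.le (gap_le_one hs.1.le)
  calc C * gap p s ^ n ≤ |C| * gap p s ^ n :=
        mul_le_mul_of_nonneg_right (le_abs_self C) (by positivity)
    _ ≤ |C| * gap p s ^ 0 := by
        rw [pow_zero]
        exact mul_le_mul_of_nonneg_left h2 (abs_nonneg C)

end GapBounded

theorem gapBounded_zero {p C : ℝ} {φ : ℝ → ℝ} (hm : Measurable φ)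
    (hb : ∀ s ∈ Ioo (0 : ℝ) 1, |φ s| ≤ C) : GapBounded p 0 φ :=
  ⟨hm, C, fun s hs => by simpa using hb s hs⟩

theorem gapBounded_one {p C : ℝ} {φ : ℝ → ℝ} (hp : 1 < p) (hC : 0 ≤ C) (hm : Measurable φ)
    (hb : ∀ s ∈ Ioo (0 : ℝ) 1, |φ s| ≤ C * (1 - s)) : GapBounded p 1 φ :=
  ⟨hm, C, fun s hs => by
    rw [pow_one]
    exact (hb s hs).trans
      (mul_le_mul_of_nonneg_left (one_sub_le_gap hp (Ioo_subset_Icc_self hs)) hC)⟩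

theorem gapBounded_one_sub_sq {p : ℝ} (hp : 1 < p) : GapBounded p 1 fun s => 1 - s ^ 2 :=
  ⟨by fun_prop, 1, fun s hs => by
    rw [pow_one, one_mul, abs_of_nonneg (by nlinarith [hs.1, hs.2])]
    exact one_sub_sq_le_gap hp (Ioo_subset_Icc_self hs)⟩

theorem gapBounded_ripple {p α : ℝ} (hp : 1 < p) (hα : 0 < α) : GapBounded p 1 (ripple α) :=
  ⟨measurable_ripple α, 1, fun s hs => by
    rw [pow_one, one_mul]
    exact (ripple_abs_le hα (Ioo_subset_Icc_self hs)).trans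
      (one_sub_sq_le_gap hp (Ioo_subset_Icc_self hs))⟩

theorem gapBounded_pert {p α : ℝ} (hp : 1 < p) (hα : 0 < α) : GapBounded p 1 (pert p α) :=
  ⟨measurable_pert p α, (p + 1) / 2 * α ^ (1 - p), fun s hs => by
    rw [pow_one, abs_of_nonneg (pert_nonneg hp hα (Ioo_subset_Icc_self hs))]
    exact pert_le hp hα (Ioo_subset_Icc_self hs)⟩

theorem gapInt_const_mul {p : ℝ} {n : ℕ} (c : ℝ) (φ : ℝ → ℝ) :
    gapInt p n (fun s => c * φ s) = c * gapInt p n φ := by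
  unfold gapInt
  rw [← intervalIntegral.integral_const_mul]
  simp only [mul_div_assoc]

theorem gapInt_add {p : ℝ} {n : ℕ} {φ ψ : ℝ → ℝ} (hp : 1 < p) (h : GapBounded p n φ)
    (h' : GapBounded p n ψ) :
    gapInt p n (fun s => φ s + ψ s) = gapInt p n φ + gapInt p n ψ := by
  unfold gapInt
  rw [← intervalIntegral.integral_add (h.intervalIntegrable hp) (h'.intervalIntegrable hp)]
  simp only [add_div]

theorem gapInt_sub {p : ℝ} {n : ℕ} {φ ψ : ℝ → ℝ} (hp : 1 < p) (h : GapBounded p n φ)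
    (h' : GapBounded p n ψ) :
    gapInt p n (fun s => φ s - ψ s) = gapInt p n φ - gapInt p n ψ := by
  unfold gapInt
  rw [← intervalIntegral.integral_sub (h.intervalIntegrable hp) (h'.intervalIntegrable hp)]
  simp only [sub_div]

theorem C0_integrable {p : ℝ} (hp : 1 < p) :
    IntervalIntegrable (fun s => 1 / √(gap p s)) volume 0 1 := by
  simpa using (gapBounded_zero (C := 1) (p := p) (φ := fun _ => 1) measurable_const
    (by simp)).intervalIntegrable hp

theorem abs_integral_le_C0 {p C : ℝ} (hp : 1 < p) {φ : ℝ → ℝ}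
    (hb : ∀ s ∈ Ioo (0 : ℝ) 1, |φ s| ≤ C * (1 / √(gap p s))) :
    |∫ s in (0 : ℝ)..1, φ s| ≤ C * C0 p := by
  have h1 : C * C0 p = ∫ s in (0 : ℝ)..1, C * (1 / √(gap p s)) := by
    rw [intervalIntegral.integral_const_mul]
    rfl
  rw [h1, ← Real.norm_eq_abs, integral_of_le zero_le_one, integral_of_le zero_le_one,
    integral_Ioc_eq_integral_Ioo, integral_Ioc_eq_integral_Ioo]
  have hi := (C0_integrable hp).const_mul C
  rw [intervalIntegrable_iff_integrableOn_Ioo_of_le zero_le_one] at hi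
  exact norm_integral_le_of_norm_le hi
    ((ae_restrict_mem measurableSet_Ioo).mono fun s hs => hb s hs)

theorem abs_gapInt_le {p C : ℝ} {n : ℕ} {φ : ℝ → ℝ} (hp : 1 < p)
    (hb : ∀ s ∈ Ioo (0 : ℝ) 1, |φ s| ≤ C * gap p s ^ n) : |gapInt p n φ| ≤ C * C0 p :=
  abs_integral_le_C0 hp fun s hs => abs_div_gap_le hp hs (hb s hs)

theorem C0_pos {p : ℝ} (hp : 1 < p) : 0 < C0 p := by
  refine intervalIntegral_pos_of_pos_on (C0_integrable hp) (fun s hs => ?_) one_pos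
  have := sqrt_gap_pos hp hs
  positivity

/-! ### The coefficients as weighted integrals -/

theorem rpow_three_halves {x : ℝ} (hx : 0 ≤ x) : x ^ (3 / 2 : ℝ) = x ^ 1 * √x := by
  rw [Real.sqrt_eq_rpow, show (3 / 2 : ℝ) = 1 + 1 / 2 by norm_num,
    rpow_add_of_nonneg hx (by norm_num) (by norm_num), rpow_one, pow_one]

theorem rpow_five_halves {x : ℝ} (hx : 0 ≤ x) : x ^ (5 / 2 : ℝ) = x ^ 2 * √x := by
  rw [Real.sqrt_eq_rpow, show (5 / 2 : ℝ) = 2 + 1 / 2 by norm_num,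
    rpow_add_of_nonneg hx (by norm_num) (by norm_num), rpow_two]

theorem gapInt_one_eq {p : ℝ} (hp : 1 < p) (φ : ℝ → ℝ) :
    ∫ s in (0 : ℝ)..1, φ s / (1 - s ^ (p + 1)) ^ (3 / 2 : ℝ) = gapInt p 1 φ :=
  integral_congr_Ioo zero_le_one fun s hs => by
    have := gap_pos hp ⟨hs.1.le, hs.2⟩
    rw [← gap, rpow_three_halves this.le]

theorem gapInt_two_eq {p : ℝ} (hp : 1 < p) (φ : ℝ → ℝ) :
    ∫ s in (0 : ℝ)..1, φ s / (1 - s ^ (p + 1)) ^ (5 / 2 : ℝ) = gapInt p 2 φ :=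
  integral_congr_Ioo zero_le_one fun s hs => by
    have := gap_pos hp ⟨hs.1.le, hs.2⟩
    rw [← gap, rpow_five_halves this.le]

theorem C1_eq {p : ℝ} (hp : 1 < p) : C1 p = -((p + 1) / 8) * gapInt p 1 fun s => 1 - s ^ 2 := by
  rw [C1, gapInt_one_eq hp]

theorem C2_eq {p : ℝ} (hp : 1 < p) :
    C2 p = 3 * (p + 1) ^ 2 / 128 * gapInt p 2 fun s => (1 - s ^ 2) ^ 2 := by
  rw [C2, gapInt_two_eq hp fun s => (1 - s ^ 2) ^ 2]

theorem E4_eq {p : ℝ} (hp : 1 < p) :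
    E4 p = -((p + 1) ^ 2 / 128) * gapInt p 1 fun s => (1 - s ^ 2) ^ 2 := by
  rw [E4, gapInt_one_eq hp fun s => (1 - s ^ 2) ^ 2]

theorem E1_eq (p : ℝ) : E1 p = (p + 1) / 8 * gapInt p 0 fun s => 1 - s ^ 2 := by
  simp [E1, gapInt, gap]

/-- The substitution `s = sin^{2/(p+1)} θ`. -/
theorem integral_comp_sin_rpow {p : ℝ} (hp : 1 < p) (k : ℝ → ℝ) :
    ∫ θ in (0 : ℝ)..(π / 2), k (sin θ ^ (2 / (p + 1))) * sin θ ^ ((1 - p) / (p + 1)) =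
      (p + 1) / 2 * gapInt p 0 k := by
  have hq : 0 < p + 1 := by linarith
  have hpi : (0 : ℝ) ≤ π / 2 := by positivity
  set S : ℝ → ℝ := fun θ => sin θ ^ (2 / (p + 1)) with hS
  have hsin : ∀ θ ∈ Ioo (0 : ℝ) (π / 2), 0 < sin θ := fun θ hθ =>
    sin_pos_of_pos_of_lt_pi hθ.1 (by linarith [hθ.2])
  have hcos : ∀ θ ∈ Ioo (0 : ℝ) (π / 2), 0 < cos θ := fun θ hθ =>
    cos_pos_of_mem_Ioo ⟨by linarith [hθ.1], hθ.2⟩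
  have hd : ∀ θ ∈ Ioo (0 : ℝ) (π / 2), HasDerivWithinAt S
      (cos θ * (2 / (p + 1)) * sin θ ^ ((1 - p) / (p + 1))) (Ioo 0 (π / 2)) θ := by
    intro θ hθ
    have := (Real.hasDerivAt_sin θ).rpow_const (p := 2 / (p + 1)) (Or.inl (hsin θ hθ).ne')
    rw [show 2 / (p + 1) - 1 = (1 - p) / (p + 1) by field_simp; ring] at this
    exact this.hasDerivWithinAt
  have hmono : MonotoneOn S (Ioo 0 (π / 2)) := fun a ha b hb hab =>
    rpow_le_rpow (hsin a ha).le
      (sin_le_sin_of_le_of_le_pi_div_two (by linarith [ha.1]) hb.2.le hab) (by positivity)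
  have himg : S '' Ioo 0 (π / 2) = Ioo 0 1 := by
    ext s
    constructor
    · rintro ⟨θ, hθ, rfl⟩
      refine ⟨rpow_pos_of_pos (hsin θ hθ) _, rpow_lt_one (hsin θ hθ).le ?_ (by positivity)⟩
      have := sin_lt_sin_of_lt_of_le_pi_div_two (by linarith [hθ.1]) le_rfl hθ.2
      rwa [sin_pi_div_two] at this
    · intro hs
      have h0 : 0 < s ^ ((p + 1) / 2) := rpow_pos_of_pos hs.1 _
      have h1 : s ^ ((p + 1) / 2) < 1 := rpow_lt_one hs.1.le hs.2 (by positivity)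
      refine ⟨arcsin (s ^ ((p + 1) / 2)), ⟨arcsin_pos.2 h0, arcsin_lt_pi_div_two.2 h1⟩, ?_⟩
      simp only [hS]
      rw [sin_arcsin (by linarith) h1.le, ← rpow_mul hs.1.le,
        show (p + 1) / 2 * (2 / (p + 1)) = 1 by field_simp, rpow_one]
  -- The monotone change of variables asks nothing of `k`. Since `1 - S^{p+1} = cos² θ`, the weight
  -- `1/√gap` cancels the cosine in `dS`.
  have hmain := integral_image_eq_integral_deriv_smul_of_monotoneOn measurableSet_Ioo hd hmono
    (fun s => k s / (gap p s ^ 0 * √(gap p s)))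
  rw [himg] at hmain
  rw [gapInt, integral_of_le zero_le_one, integral_of_le hpi, integral_Ioc_eq_integral_Ioo,
    integral_Ioc_eq_integral_Ioo, hmain, ← MeasureTheory.integral_const_mul]
  refine setIntegral_congr_fun measurableSet_Ioo fun θ hθ => ?_
  have h1 : gap p (S θ) = cos θ ^ 2 := by
    simp only [gap, hS]
    rw [← rpow_mul (hsin θ hθ).le, show 2 / (p + 1) * (p + 1) = 2 by field_simp, rpow_two,
      cos_sq']
  have h2 := hcos θ hθ
  simp only [h1, Real.sqrt_sq h2.le, pow_zero, one_mul, smul_eq_mul]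
  change k (S θ) * _ = _
  field_simp

theorem sin_rpow_mul {p θ : ℝ} (hθ : θ ∈ Ioo (0 : ℝ) (π / 2)) :
    sin θ ^ ((3 - p) / (p + 1)) = sin θ ^ (2 / (p + 1)) * sin θ ^ ((1 - p) / (p + 1)) := by
  rw [← rpow_add (sin_pos_of_pos_of_lt_pi hθ.1 (by linarith [hθ.2, pi_pos]))]
  congr 1
  ring

theorem C11_eq {p : ℝ} (hp : 1 < p) (α : ℝ) :
    C11 p α = gapInt p 0 fun s => s * cos (2 * α * s) := by
  have h := integral_comp_sin_rpow hp fun s => s * cos (2 * α * s)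
  have hq : p + 1 ≠ 0 := by linarith
  rw [C11, integral_congr_Ioo (by positivity) (fun θ hθ => by
    rw [sin_rpow_mul hθ, ← mul_assoc, mul_comm (cos _)]), h]
  generalize gapInt p 0 _ = x
  field_simp

theorem C21_eq {p : ℝ} (hp : 1 < p) (α : ℝ) :
    C21 p α = -(1 / 2) * gapInt p 0 fun s => s * sin (2 * α * s) := by
  have h := integral_comp_sin_rpow hp fun s => s * sin (2 * α * s)
  have hq : p + 1 ≠ 0 := by linarith
  rw [C21, integral_congr_Ioo (by positivity) (fun θ hθ => by
    rw [sin_rpow_mul hθ, ← mul_assoc, mul_comm (sin (2 * α * _))]), h]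
  generalize gapInt p 0 _ = x
  field_simp

theorem C22_eq {p : ℝ} (hp : 1 < p) (α : ℝ) :
    C22 p α = (p - 1) / 8 * gapInt p 0 fun s => cos (2 * α) - cos (2 * α * s) := by
  have h := integral_comp_sin_rpow hp fun s => cos (2 * α) - cos (2 * α * s)
  have hq : p + 1 ≠ 0 := by linarith
  rw [C22, h]
  field_simp
  ring

theorem C12_eq {p : ℝ} (hp : 1 < p) (α : ℝ) :
    C12 p α = (p - 1) / 4 * (gapInt p 0 fun s => sin (2 * α) - sin (2 * α * s)) +
      (p + 1) / 4 * gapInt p 1 fun s => (1 - s) * sin (2 * α * s) := by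
  have h := integral_comp_sin_rpow hp fun s => sin (2 * α) - sin (2 * α * s)
  have hq : p + 1 ≠ 0 := by linarith
  rw [C12, h, ← gapInt_one_eq hp]
  simp only [div_mul_eq_mul_div]
  congr 1
  field_simp
  ring

theorem E2_eq {p : ℝ} (hp : 1 < p) (α : ℝ) :
    E2 p α = -((p + 1) / 8) * gapInt p 0 fun s => sin (2 * α) - s * sin (2 * α * s) := by
  have h := integral_comp_sin_rpow hp fun s => sin (2 * α) - s * sin (2 * α * s)
  rw [E2, h]
  ring

theorem E3_eq {p : ℝ} (hp : 1 < p) (α : ℝ) :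
    E3 p α = -((p + 1) / 16) * gapInt p 0 fun s => cos (2 * α) - cos (2 * α * s) := by
  have h := integral_comp_sin_rpow hp fun s => cos (2 * α) - cos (2 * α * s)
  rw [E3, h]
  ring

/-- Integration by parts against `(1 - s^{p+1})^{-3/2}`. -/
theorem gapInt_one_sub_eq {p L : ℝ} (hp : 1 < p) {k k' : ℝ → ℝ}
    (hk : ∀ s, HasDerivAt k (k' s) s) (hL : ∀ s, |k' s| ≤ L) (hm : Measurable k') :
    GapBounded p 1 (fun s => k 1 - k s) ∧
    gapInt p 1 (fun s => k 1 - k s) =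
      2 / (p + 1) * ((p - 1) / 2 * gapInt p 0 (fun s => k 1 - k s) +
        gapInt p 0 fun s => s * k' s) := by
  have hL0 : 0 ≤ L := (abs_nonneg _).trans (hL 0)
  have hkc : Continuous k := continuous_iff_continuousAt.2 fun s => (hk s).continuousAt
  have hlip : ∀ s ≤ (1 : ℝ), |k 1 - k s| ≤ L * (1 - s) := by
    intro s hs
    have := convex_univ.norm_image_sub_le_of_norm_hasDerivWithin_le (f := k) (f' := k') (C := L)
      (fun x _ => (hk x).hasDerivWithinAt) (fun x _ => hL x) (mem_univ s) (mem_univ (1 : ℝ))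
    rwa [Real.norm_eq_abs, Real.norm_eq_abs, abs_of_nonneg (by linarith : (0 : ℝ) ≤ 1 - s)]
      at this
  have hb1 : GapBounded p 1 (fun s => k 1 - k s) :=
    gapBounded_one hp hL0 (by fun_prop) fun s hs => hlip s hs.2.le
  refine ⟨hb1, ?_⟩
  have hb0 := hb1.zero_of_le hp
  have hbk : GapBounded p 0 (fun s => s * k' s) :=
    gapBounded_zero (C := L) (by fun_prop) fun s hs => by
      rw [abs_mul, abs_of_pos hs.1]
      exact (mul_le_of_le_one_left (abs_nonneg _) hs.2.le).trans (hL s)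
  have hq : p + 1 ≠ 0 := by linarith
  -- The extra factor `s` turns the `s^p` from the derivative of `gap` into `s^{p+1} = 1 - gap`, so
  -- `H'` involves only the weights `gap^{-3/2}` and `gap^{-1/2}`; it also makes `H 0 = 0`.
  set H : ℝ → ℝ := fun s => (k 1 - k s) * s / √(gap p s) with hH
  have hgc : Continuous (gap p) := by
    unfold gap
    have : Continuous fun u : ℝ => u ^ (p + 1) := Real.continuous_rpow_const (by linarith)
    fun_prop
  -- Only `s = 1` is delicate: there the Lipschitz bound on `k` gives `|H s| ≤ L √(1 - s)`, so no
  -- boundary term survives.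
  have hHc : ContinuousOn H (uIcc 0 1) := by
    rw [uIcc_of_le zero_le_one]
    intro s hs
    rcases hs.2.eq_or_lt with rfl | h1
    · have hH1 : H 1 = 0 := by simp [hH]
      rw [ContinuousWithinAt, hH1]
      have hlim : Tendsto (fun s : ℝ => L * √(1 - s)) (𝓝[Icc 0 1] 1) (𝓝 0) := by
        have : Continuous fun s : ℝ => L * √(1 - s) := by fun_prop
        have := this.tendsto 1
        simp only [sub_self, Real.sqrt_zero, mul_zero] at this
        exact this.mono_left nhdsWithin_le_nhds
      refine squeeze_zero_norm' ?_ hlim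
      filter_upwards [self_mem_nhdsWithin] with t ht
      rcases ht.2.eq_or_lt with rfl | h1
      · simp [hH]
      have h2 : 0 < √(1 - t) := Real.sqrt_pos.2 (by linarith)
      have h3 : √(1 - t) ≤ √(gap p t) := Real.sqrt_le_sqrt (one_sub_le_gap hp ht)
      rw [Real.norm_eq_abs, abs_div, abs_mul, abs_of_nonneg (Real.sqrt_nonneg (gap p t)),
        abs_of_nonneg ht.1, div_le_iff₀ (h2.trans_le h3)]
      calc |k 1 - k t| * t ≤ L * (1 - t) * 1 :=
            mul_le_mul (hlip t ht.2) ht.2 ht.1 (mul_nonneg hL0 (by linarith))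
        _ = L * √(1 - t) * √(1 - t) := by
            rw [mul_one, mul_assoc L, Real.mul_self_sqrt (by linarith)]
        _ ≤ _ := by gcongr
    · refine ContinuousAt.continuousWithinAt ?_
      refine ContinuousAt.div (by fun_prop) (hgc.sqrt.continuousAt) ?_
      exact (Real.sqrt_pos.2 (gap_pos hp ⟨hs.1, h1⟩)).ne'
  set H' : ℝ → ℝ := fun s => (p + 1) / 2 * ((k 1 - k s) / (gap p s ^ 1 * √(gap p s))) -
    ((p - 1) / 2 * ((k 1 - k s) / (gap p s ^ 0 * √(gap p s))) +
      s * k' s / (gap p s ^ 0 * √(gap p s))) with hH'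
  have hHd : ∀ s ∈ Ioo (0 : ℝ) 1, HasDerivAt H (H' s) s := by
    intro s hs
    have hg := gap_pos hp ⟨hs.1.le, hs.2⟩
    have hsg := sqrt_gap_pos hp hs
    have h1 : HasDerivAt (gap p) (-((p + 1) * s ^ p)) s := by
      have := (Real.hasDerivAt_rpow_const (x := s) (p := p + 1) (Or.inl hs.1.ne')).const_sub 1
      rwa [add_sub_cancel_right] at this
    have h2 := (((hk s).const_sub (k 1)).mul (hasDerivAt_id s)).div (h1.sqrt hg.ne') hsg.ne'
    refine h2.congr_deriv ?_
    have h3 : s ^ p * s = 1 - gap p s := by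
      rw [gap, rpow_add hs.1, rpow_one]
      ring
    have h4 : √(gap p s) ^ 2 = gap p s := Real.sq_sqrt hg.le
    have h5 : gap p s ≠ 0 := hg.ne'
    simp only [hH', id, pow_zero, one_mul, pow_one, Pi.mul_apply]
    rw [h4]
    field_simp
    rw [h4]
    linear_combination (k 1 - k s) * (p + 1) * h3
  have hint := integral_eq_of_hasDerivAt_off_countable H H' countable_empty hHc
    (fun s hs => by
      rw [min_eq_left zero_le_one, max_eq_right zero_le_one] at hs
      exact hHd s hs.1)
    (((hb1.intervalIntegrable hp).const_mul _).sub
      (((hb0.intervalIntegrable hp).const_mul _).add (hbk.intervalIntegrable hp)))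
  have hH01 : H 1 - H 0 = 0 := by simp [hH]
  rw [hH01, hH', intervalIntegral.integral_sub ((hb1.intervalIntegrable hp).const_mul _)
      (((hb0.intervalIntegrable hp).const_mul _).add (hbk.intervalIntegrable hp)),
    intervalIntegral.integral_add ((hb0.intervalIntegrable hp).const_mul _)
      (hbk.intervalIntegrable hp), intervalIntegral.integral_const_mul,
    intervalIntegral.integral_const_mul] at hint
  change (p + 1) / 2 * gapInt p 1 (fun s => k 1 - k s) -
    ((p - 1) / 2 * gapInt p 0 (fun s => k 1 - k s) + gapInt p 0 fun s => s * k' s) = 0 at hint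
  generalize gapInt p 1 _ = x at hint ⊢
  generalize (gapInt p 0 fun s => k 1 - k s) = y at hint ⊢
  generalize gapInt p 0 _ = z at hint ⊢
  field_simp
  linear_combination 2 * hint

/-! ### Second-order expansion of the time map and the velocity integral -/

theorem one_div_sqrt_add_expansion {g d : ℝ} (hg : 0 < g) (hd : 0 ≤ d) :
    |1 / √(g + d) - (1 / √g - 1 / 2 * (d / (g ^ 1 * √g)) + 3 / 8 * (d ^ 2 / (g ^ 2 * √g)))| ≤
      d ^ 3 / (g ^ 3 * √g) := by
  -- With `z = √g` and `y = √(g+d)` the claim is rational. The remainder has the factor `(y - z)³`,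
  -- and `d³ = (y - z)³ (y + z)³`.
  obtain ⟨z, hz, rfl⟩ : ∃ z, 0 < z ∧ g = z ^ 2 :=
    ⟨√g, Real.sqrt_pos.2 hg, (Real.sq_sqrt hg.le).symm⟩
  obtain ⟨y, hy, hyd⟩ : ∃ y, 0 < y ∧ z ^ 2 + d = y ^ 2 :=
    ⟨√(z ^ 2 + d), Real.sqrt_pos.2 (by positivity), (Real.sq_sqrt (by positivity)).symm⟩
  obtain rfl : d = y ^ 2 - z ^ 2 := by linarith
  have hzy : z ≤ y := le_of_sq_le_sq (by linarith) hy.le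
  rw [hyd, Real.sqrt_sq hy.le, Real.sqrt_sq hz.le]
  have key : 1 / y - (1 / z - 1 / 2 * ((y ^ 2 - z ^ 2) / ((z ^ 2) ^ 1 * z)) +
      3 / 8 * ((y ^ 2 - z ^ 2) ^ 2 / ((z ^ 2) ^ 2 * z))) =
      -((y - z) ^ 3 * (3 * y ^ 2 + 9 * y * z + 8 * z ^ 2) / (8 * y * z ^ 5)) := by
    field_simp
    ring
  have h0 : 0 ≤ (y - z) ^ 3 := pow_nonneg (by linarith) 3
  rw [key, abs_neg, abs_of_nonneg (by positivity), div_le_div_iff₀ (by positivity) (by positivity)]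
  have h1 : (3 * y ^ 2 + 9 * y * z + 8 * z ^ 2) * z ^ 2 ≤ (y + z) ^ 3 * (8 * y) := by
    have e1 : z ^ 2 ≤ y ^ 2 := pow_le_pow_left₀ hz.le hzy 2
    have e3 : (3 * y ^ 2 + 9 * y * z + 8 * z ^ 2) * z ^ 2 =
      3 * y ^ 2 * z ^ 2 + 9 * (y * z) * z ^ 2 + 8 * z ^ 2 * z ^ 2 := by ring
    have e4 : z ^ 2 * z ^ 2 ≤ y ^ 2 * z ^ 2 := mul_le_mul_of_nonneg_right e1 (by positivity)
    have e5 : y * z * z ^ 2 ≤ y * z * y ^ 2 := mul_le_mul_of_nonneg_left e1 (by positivity)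
    have e6 : 0 ≤ y * y ^ 3 := by positivity
    have e7 : 0 ≤ y * z ^ 3 := by positivity
    nlinarith
  calc (y - z) ^ 3 * (3 * y ^ 2 + 9 * y * z + 8 * z ^ 2) * ((z ^ 2) ^ 3 * z)
      = (y - z) ^ 3 * ((3 * y ^ 2 + 9 * y * z + 8 * z ^ 2) * z ^ 2) * z ^ 5 := by ring
    _ ≤ (y - z) ^ 3 * ((y + z) ^ 3 * (8 * y)) * z ^ 5 := by gcongr
    _ = _ := by ring

/-- The same substitution `z = √g`, `y = √(g+d)` again exhibits `(y - z)³` in the remainder. -/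
theorem sqrt_add_expansion {g d : ℝ} (hg : 0 < g) (hd : 0 ≤ d) :
    |√(g + d) - (√g + 1 / 2 * (d / (g ^ 0 * √g)) - 1 / 8 * (d ^ 2 / (g ^ 1 * √g)))| ≤
      d ^ 3 / (g ^ 2 * √g) := by
  obtain ⟨z, hz, rfl⟩ : ∃ z, 0 < z ∧ g = z ^ 2 :=
    ⟨√g, Real.sqrt_pos.2 hg, (Real.sq_sqrt hg.le).symm⟩
  obtain ⟨y, hy, hyd⟩ : ∃ y, 0 < y ∧ z ^ 2 + d = y ^ 2 :=
    ⟨√(z ^ 2 + d), Real.sqrt_pos.2 (by positivity), (Real.sq_sqrt (by positivity)).symm⟩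
  obtain rfl : d = y ^ 2 - z ^ 2 := by linarith
  have hzy : z ≤ y := le_of_sq_le_sq (by linarith) hy.le
  rw [hyd, Real.sqrt_sq hy.le, Real.sqrt_sq hz.le]
  have key : y - (z + 1 / 2 * ((y ^ 2 - z ^ 2) / ((z ^ 2) ^ 0 * z)) -
      1 / 8 * ((y ^ 2 - z ^ 2) ^ 2 / ((z ^ 2) ^ 1 * z))) =
      (y - z) ^ 3 * (y + 3 * z) / (8 * z ^ 3) := by
    field_simp
    ring
  have h0 : 0 ≤ (y - z) ^ 3 := pow_nonneg (by linarith) 3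
  rw [key, abs_of_nonneg (by positivity), div_le_div_iff₀ (by positivity) (by positivity)]
  have h1 : (y + 3 * z) * z ^ 2 ≤ (y + z) ^ 3 * 8 := by
    have e1 : 0 ≤ y ^ 3 := by positivity
    have e2 : 0 ≤ y ^ 2 * z := by positivity
    have e3 : 0 ≤ y * z ^ 2 := by positivity
    have e4 : 0 ≤ z ^ 3 := by positivity
    nlinarith
  calc (y - z) ^ 3 * (y + 3 * z) * ((z ^ 2) ^ 2 * z)
      = (y - z) ^ 3 * ((y + 3 * z) * z ^ 2) * z ^ 3 := by ring
    _ ≤ (y - z) ^ 3 * ((y + z) ^ 3 * 8) * z ^ 3 := by gcongr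
    _ = _ := by ring

theorem pert_cube_le {p α s : ℝ} (hp : 1 < p) (hα : 0 < α) (hs : s ∈ Ioo (0 : ℝ) 1) :
    pert p α s ^ 3 ≤ ((p + 1) / 2 * α ^ (1 - p)) ^ 3 * gap p s ^ 3 := by
  rw [← mul_pow]
  exact pow_le_pow_left₀ (pert_nonneg hp hα (Ioo_subset_Icc_self hs))
    (pert_le hp hα (Ioo_subset_Icc_self hs)) 3

theorem normTime_expansion {p α : ℝ} (hp : 1 < p) (hα : 0 < α) :
    |normTime p α - (C0 p - 1 / 2 * gapInt p 1 (pert p α) +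
      3 / 8 * gapInt p 2 fun s => pert p α s ^ 2)| ≤
      ((p + 1) / 2 * α ^ (1 - p)) ^ 3 * C0 p := by
  have hb1 := (gapBounded_pert hp hα)
  have i0 := C0_integrable hp
  have i1 := hb1.intervalIntegrable hp
  have i2 := hb1.sq.intervalIntegrable hp
  have hg := measurable_gap p
  have hpt := measurable_pert p α
  have iT : IntervalIntegrable (fun s => 1 / √(gap p s + pert p α s)) volume 0 1 := by
    refine intervalIntegrable_of_abs_le (C := 1)
      (Measurable.aestronglyMeasurable (by fun_prop)) fun s hs => ?_
    have h2 : 1 - s ≤ gap p s + pert p α s := by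
      have := one_sub_le_gap hp (Ioo_subset_Icc_self hs)
      have := pert_nonneg hp hα (Ioo_subset_Icc_self hs)
      linarith
    have h3 : 0 < √(1 - s) := Real.sqrt_pos.2 (by linarith [hs.2])
    rw [abs_of_nonneg (by positivity), one_mul]
    gcongr
  have heq : normTime p α - (C0 p - 1 / 2 * gapInt p 1 (pert p α) +
      3 / 8 * gapInt p 2 fun s => pert p α s ^ 2) =
      ∫ s in (0 : ℝ)..1, (1 / √(gap p s + pert p α s) - (1 / √(gap p s) -
        1 / 2 * (pert p α s / (gap p s ^ 1 * √(gap p s))) +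
        3 / 8 * (pert p α s ^ 2 / (gap p s ^ 2 * √(gap p s))))) := by
    rw [intervalIntegral.integral_sub iT ((i0.sub (i1.const_mul _)).add (i2.const_mul _)),
      intervalIntegral.integral_add (i0.sub (i1.const_mul _)) (i2.const_mul _),
      intervalIntegral.integral_sub i0 (i1.const_mul _), intervalIntegral.integral_const_mul,
      intervalIntegral.integral_const_mul]
    rfl
  rw [heq]
  refine abs_integral_le_C0 hp fun s hs => ?_
  have h1 := gap_pos hp ⟨hs.1.le, hs.2⟩
  have h2 := sqrt_gap_pos hp hs
  refine (one_div_sqrt_add_expansion h1 (pert_nonneg hp hα (Ioo_subset_Icc_self hs))).trans ?_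
  rw [div_le_iff₀ (by positivity)]
  refine (pert_cube_le hp hα hs).trans (le_of_eq ?_)
  field_simp

theorem normVel_expansion {p α : ℝ} (hp : 1 < p) (hα : 0 < α) :
    |normVel p α - (E0 p + 1 / 2 * gapInt p 0 (pert p α) -
      1 / 8 * gapInt p 1 fun s => pert p α s ^ 2)| ≤
      ((p + 1) / 2 * α ^ (1 - p)) ^ 3 * C0 p := by
  have hb1 := (gapBounded_pert hp hα)
  have hb2 : GapBounded p 1 fun s => pert p α s ^ 2 := by
    have := (hb1.zero_of_le hp).mul hb1
    simpa [pow_two] using this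
  have hc : Continuous (gap p) := by
    unfold gap
    have : Continuous fun u : ℝ => u ^ (p + 1) := Real.continuous_rpow_const (by linarith)
    fun_prop
  have hcp : Continuous (pert p α) := by
    unfold pert sinPot
    fun_prop
  have i0 : IntervalIntegrable (fun s => √(gap p s)) volume 0 1 :=
    hc.sqrt.intervalIntegrable _ _
  have i1 := (hb1.zero_of_le hp).intervalIntegrable hp
  have i2 := hb2.intervalIntegrable hp
  have iT : IntervalIntegrable (fun s => √(gap p s + pert p α s)) volume 0 1 :=
    (hc.add hcp).sqrt.intervalIntegrable _ _
  have heq : normVel p α - (E0 p + 1 / 2 * gapInt p 0 (pert p α) -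
      1 / 8 * gapInt p 1 fun s => pert p α s ^ 2) =
      ∫ s in (0 : ℝ)..1, (√(gap p s + pert p α s) - (√(gap p s) +
        1 / 2 * (pert p α s / (gap p s ^ 0 * √(gap p s))) -
        1 / 8 * (pert p α s ^ 2 / (gap p s ^ 1 * √(gap p s))))) := by
    rw [intervalIntegral.integral_sub iT ((i0.add (i1.const_mul _)).sub (i2.const_mul _)),
      intervalIntegral.integral_sub (i0.add (i1.const_mul _)) (i2.const_mul _),
      intervalIntegral.integral_add i0 (i1.const_mul _), intervalIntegral.integral_const_mul,
      intervalIntegral.integral_const_mul]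
    rfl
  rw [heq]
  refine abs_integral_le_C0 hp fun s hs => ?_
  have h1 := gap_pos hp ⟨hs.1.le, hs.2⟩
  have h2 := sqrt_gap_pos hp hs
  have h3 := gap_le_one (p := p) hs.1.le
  have h4 : 0 < α ^ (1 - p) := rpow_pos_of_pos hα _
  have h5 : 0 < p + 1 := by linarith
  refine (sqrt_add_expansion h1 (pert_nonneg hp hα (Ioo_subset_Icc_self hs))).trans ?_
  rw [div_le_iff₀ (by positivity)]
  refine (pert_cube_le hp hα hs).trans ?_
  have : ((p + 1) / 2 * α ^ (1 - p)) ^ 3 * (1 / √(gap p s)) * (gap p s ^ 2 * √(gap p s)) =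
      ((p + 1) / 2 * α ^ (1 - p)) ^ 3 * gap p s ^ 2 := by field_simp
  rw [this]
  exact mul_le_mul_of_nonneg_left (pow_le_pow_of_le_one h1.le h3 (by norm_num)) (by positivity)

/-! ### The first-order terms -/

theorem hasDerivAt_sin_mul (c s : ℝ) : HasDerivAt (fun s => sin (c * s)) (c * cos (c * s)) s := by
  have h2 : HasDerivAt (fun u : ℝ => c * u) c s := by simpa using (hasDerivAt_id s).const_mul c
  exact ((Real.hasDerivAt_sin _).comp s h2).congr_deriv (mul_comm _ _)

theorem hasDerivAt_cos_mul (c s : ℝ) :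
    HasDerivAt (fun s => cos (c * s)) (-(c * sin (c * s))) s := by
  have h2 : HasDerivAt (fun u : ℝ => c * u) c s := by simpa using (hasDerivAt_id s).const_mul c
  refine ((Real.hasDerivAt_cos _).comp s h2).congr_deriv ?_
  ring

theorem gapBounded_one_sub_mul_sin {p : ℝ} (hp : 1 < p) (c : ℝ) :
    GapBounded p 1 fun s => (1 - s) * sin (c * s) :=
  gapBounded_one (C := 1) hp zero_le_one (by fun_prop) fun s hs => by
    rw [abs_mul, abs_of_pos (by linarith [hs.2] : 0 < 1 - s), one_mul]
    exact mul_le_of_le_one_right (by linarith [hs.2]) (abs_sin_le_one _)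

/-- For `c = 2α` the factor `c` on the right compensates the `1/α` in `ripple`; this is the origin
of `C11` at the order of `C1`. -/
theorem sin_sub_by_parts {p : ℝ} (hp : 1 < p) (c : ℝ) :
    GapBounded p 1 (fun s => sin c - sin (c * s)) ∧
    gapInt p 1 (fun s => sin c - sin (c * s)) =
      2 / (p + 1) * ((p - 1) / 2 * gapInt p 0 (fun s => sin c - sin (c * s)) +
        c * gapInt p 0 fun s => s * cos (c * s)) := by
  have := gapInt_one_sub_eq hp (hasDerivAt_sin_mul c) (L := |c|) (fun s => by
    rw [abs_mul]
    exact mul_le_of_le_one_right (abs_nonneg _) (abs_cos_le_one _)) (by fun_prop)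
  simp only [mul_one, mul_left_comm _ c] at this
  rwa [gapInt_const_mul c] at this

theorem cos_sub_by_parts {p : ℝ} (hp : 1 < p) (c : ℝ) :
    GapBounded p 1 (fun s => cos c - cos (c * s)) ∧
    gapInt p 1 (fun s => cos c - cos (c * s)) =
      2 / (p + 1) * ((p - 1) / 2 * gapInt p 0 (fun s => cos c - cos (c * s)) -
        c * gapInt p 0 fun s => s * sin (c * s)) := by
  have := gapInt_one_sub_eq hp (hasDerivAt_cos_mul c) (L := |c|) (fun s => by
    rw [abs_neg, abs_mul]
    exact mul_le_of_le_one_right (abs_nonneg _) (abs_sin_le_one _)) (by fun_prop)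
  simp only [mul_one, ← neg_mul, mul_left_comm _ (-c)] at this
  rwa [gapInt_const_mul (-c), neg_mul, ← sub_eq_add_neg] at this

/-- The differences `k 1 - k s` are suited to integration by parts, while `(1 - s) sin` already
vanishes at `1` uniformly in `α` and becomes the second part of `C12`. -/
theorem ripple_eq (α s : ℝ) :
    ripple α s = 1 / α * ((sin (2 * α) - sin (2 * α * s)) + (1 - s) * sin (2 * α * s)) +
      1 / (2 * α ^ 2) * (cos (2 * α) - cos (2 * α * s)) := by
  unfold ripple
  ring

theorem gapInt_pert {p α : ℝ} {n : ℕ} (hp : 1 < p) (hα : 0 < α)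
    (h1 : GapBounded p n fun s => 1 - s ^ 2) (h2 : GapBounded p n (ripple α)) :
    gapInt p n (pert p α) = (p + 1) / 4 * α ^ (1 - p) *
      ((gapInt p n fun s => 1 - s ^ 2) - gapInt p n (ripple α)) := by
  rw [← gapInt_sub hp h1 h2, ← gapInt_const_mul]
  exact gapInt_congr fun s _ => pert_eq hα s

theorem gapInt_one_pert {p α : ℝ} (hp : 1 < p) (hα : 0 < α) :
    -(1 / 2) * gapInt p 1 (pert p α) = α ^ (1 - p) *
      (C1 p + 1 / 2 * C11 p α + 1 / 2 * (C12 p α + C21 p α) / α +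
        1 / 2 * C22 p α / α ^ 2) := by
  obtain ⟨hs, hs'⟩ := sin_sub_by_parts hp (2 * α)
  obtain ⟨hc, hc'⟩ := cos_sub_by_parts hp (2 * α)
  have hm := gapBounded_one_sub_mul_sin hp (2 * α)
  have hr : gapInt p 1 (ripple α) =
      1 / α * ((gapInt p 1 fun s => sin (2 * α) - sin (2 * α * s)) +
        gapInt p 1 fun s => (1 - s) * sin (2 * α * s)) +
      1 / (2 * α ^ 2) * gapInt p 1 fun s => cos (2 * α) - cos (2 * α * s) := by
    rw [← gapInt_add hp hs hm, ← gapInt_const_mul, ← gapInt_const_mul,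
      ← gapInt_add hp ((hs.add hm).const_mul _) (hc.const_mul _)]
    exact gapInt_congr fun s _ => ripple_eq α s
  rw [gapInt_pert hp hα (gapBounded_one_sub_sq hp) (gapBounded_ripple hp hα), hr, hs', hc',
    C1_eq hp, C11_eq hp, C12_eq hp, C21_eq hp, C22_eq hp]
  have hq : p + 1 ≠ 0 := by linarith
  generalize (gapInt p 1 fun s => 1 - s ^ 2) = x1
  generalize (gapInt p 0 fun s => sin (2 * α) - sin (2 * α * s)) = x2
  generalize (gapInt p 0 fun s => cos (2 * α) - cos (2 * α * s)) = x3
  generalize (gapInt p 1 fun s => (1 - s) * sin (2 * α * s)) = x4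
  generalize (gapInt p 0 fun s => s * cos (2 * α * s)) = x5
  generalize (gapInt p 0 fun s => s * sin (2 * α * s)) = x6
  field_simp
  ring

theorem gapBounded_sin_sub {p : ℝ} (c : ℝ) :
    GapBounded p 0 fun s => sin c - s * sin (c * s) :=
  gapBounded_zero (C := 1 + 1) (by fun_prop) fun s hs => by
    refine (abs_sub _ _).trans (add_le_add (abs_sin_le_one _) ?_)
    rw [abs_mul, abs_of_pos hs.1]
    exact mul_le_one₀ hs.2.le (abs_nonneg _) (abs_sin_le_one _)

/-- The weight `gap^{-1/2}` is integrable by itself, so no integration by parts is made and the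
oscillations stay at relative order `1/α`. -/
theorem gapInt_zero_pert {p α : ℝ} (hp : 1 < p) (hα : 0 < α) :
    1 / 2 * gapInt p 0 (pert p α) = α ^ (1 - p) * (E1 p + E2 p α / α + E3 p α / α ^ 2) := by
  have hs := gapBounded_sin_sub (p := p) (2 * α)
  have hc := (cos_sub_by_parts hp (2 * α)).1.zero_of_le hp
  have hr : gapInt p 0 (ripple α) =
      1 / α * (gapInt p 0 fun s => sin (2 * α) - s * sin (2 * α * s)) +
      1 / (2 * α ^ 2) * gapInt p 0 fun s => cos (2 * α) - cos (2 * α * s) := by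
    rw [← gapInt_const_mul, ← gapInt_const_mul,
      ← gapInt_add hp (hs.const_mul _) (hc.const_mul _)]
    refine gapInt_congr fun s _ => ?_
    unfold ripple
    ring
  rw [gapInt_pert hp hα ((gapBounded_one_sub_sq hp).zero_of_le hp)
    ((gapBounded_ripple hp hα).zero_of_le hp), hr, E1_eq, E2_eq hp, E3_eq hp]
  have hq : p + 1 ≠ 0 := by linarith
  generalize (gapInt p 0 fun s => 1 - s ^ 2) = x1
  generalize (gapInt p 0 fun s => sin (2 * α) - s * sin (2 * α * s)) = x2
  generalize (gapInt p 0 fun s => cos (2 * α) - cos (2 * α * s)) = x3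
  field_simp
  ring

/-! ### Limits of the second-order terms -/

theorem gapInt_pert_sq {p α : ℝ} (n : ℕ) (hα : 0 < α) :
    (gapInt p n fun s => pert p α s ^ 2) = (p + 1) ^ 2 / 16 * (α ^ (1 - p)) ^ 2 *
      gapInt p n fun s => ((1 - s ^ 2) - ripple α s) ^ 2 := by
  rw [← gapInt_const_mul]
  refine gapInt_congr fun s _ => ?_
  rw [pert_eq hα]
  ring

theorem ripple_tendsto (s : ℝ) (hs : s ∈ Ioo (0 : ℝ) 1) :
    Tendsto (fun α => ripple α s) atTop (𝓝 0) := by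
  have h1 : Tendsto (fun α : ℝ => 2 * α⁻¹ + α⁻¹ ^ 2) atTop (𝓝 0) := by
    have := (tendsto_inv_atTop_zero (𝕜 := ℝ)).const_mul 2 |>.add
      ((tendsto_inv_atTop_zero (𝕜 := ℝ)).pow 2)
    simpa using this
  refine squeeze_zero_norm' ?_ h1
  filter_upwards [eventually_gt_atTop 0] with α hα
  unfold ripple
  have e1 : |sin (2 * α) - s * sin (2 * α * s)| ≤ 2 := by
    refine (abs_sub _ _).trans ?_
    have : |s * sin (2 * α * s)| ≤ 1 := by
      rw [abs_mul, abs_of_pos hs.1]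
      exact mul_le_one₀ hs.2.le (abs_nonneg _) (abs_sin_le_one _)
    linarith [abs_sin_le_one (2 * α)]
  have e2 : |cos (2 * α) - cos (2 * α * s)| ≤ 2 :=
    (abs_sub _ _).trans (by linarith [abs_cos_le_one (2 * α), abs_cos_le_one (2 * α * s)])
  rw [Real.norm_eq_abs]
  refine (abs_add_le _ _).trans (add_le_add ?_ ?_)
  · rw [abs_div, abs_of_pos hα, div_eq_mul_inv]
    gcongr
  · rw [abs_div, abs_of_pos (by positivity : 0 < 2 * α ^ 2), div_le_iff₀ (by positivity)]
    refine e2.trans (le_of_eq ?_)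
    field_simp

/-- Dominated convergence with majorant `C/√gap`. -/
theorem tendsto_gapInt {p C : ℝ} {n : ℕ} (hp : 1 < p) {φ : ℝ → ℝ → ℝ} {ψ : ℝ → ℝ}
    (hm : ∀ α, Measurable (φ α))
    (hb : ∀ᶠ α in atTop, ∀ s ∈ Ioo (0 : ℝ) 1, |φ α s| ≤ C * gap p s ^ n)
    (hl : ∀ s ∈ Ioo (0 : ℝ) 1, Tendsto (fun α => φ α s) atTop (𝓝 (ψ s))) :
    Tendsto (fun α => gapInt p n (φ α)) atTop (𝓝 (gapInt p n ψ)) := by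
  unfold gapInt
  simp only [integral_of_le zero_le_one, integral_Ioc_eq_integral_Ioo]
  have hi := (C0_integrable hp).const_mul C
  rw [intervalIntegrable_iff_integrableOn_Ioo_of_le zero_le_one] at hi
  refine tendsto_integral_filter_of_dominated_convergence _ ?_ ?_ hi ?_
  · refine Eventually.of_forall fun α => Measurable.aestronglyMeasurable ?_
    have := measurable_gap p
    have := hm α
    fun_prop
  · filter_upwards [hb] with α hα
    exact (ae_restrict_mem measurableSet_Ioo).mono fun s hs => abs_div_gap_le hp hs (hα s hs)
  · exact (ae_restrict_mem measurableSet_Ioo).mono fun s hs => (hl s hs).div_const _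

theorem tendsto_gapInt_sq {p : ℝ} {n : ℕ} (hp : 1 < p) (hn : n ≤ 2) :
    Tendsto (fun α => gapInt p n fun s => ((1 - s ^ 2) - ripple α s) ^ 2) atTop
      (𝓝 (gapInt p n fun s => (1 - s ^ 2) ^ 2)) := by
  refine tendsto_gapInt (C := 4) hp (fun α => ?_) ?_ fun s hs => ?_
  · have := measurable_ripple α
    fun_prop
  · filter_upwards [eventually_gt_atTop 0] with α hα s hs
    have h1 := abs_le.1 (ripple_abs_le hα (Ioo_subset_Icc_self hs))
    have h2 := one_sub_sq_le_gap hp (Ioo_subset_Icc_self hs)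
    have h3 := gap_pos hp ⟨hs.1.le, hs.2⟩
    have h4 := gap_le_one (p := p) hs.1.le
    have h5 : ((1 - s ^ 2) - ripple α s) ^ 2 ≤ (2 * gap p s) ^ 2 :=
      pow_le_pow_left₀ (by linarith) (by linarith) 2
    have h6 : gap p s ^ 2 ≤ gap p s ^ n := pow_le_pow_of_le_one h3.le h4 hn
    rw [abs_of_nonneg (sq_nonneg _)]
    linarith
  · have := ((ripple_tendsto s hs).const_sub (1 - s ^ 2)).pow 2
    simpa using this

/-- The Riemann–Lebesgue lemma for cosines on `(0,1)`. -/
theorem tendsto_integral_mul_cos {f : ℝ → ℝ} (hf : IntervalIntegrable f volume 0 1) :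
    Tendsto (fun α : ℝ => ∫ s in (0 : ℝ)..1, f s * cos (2 * α * s)) atTop (𝓝 0) := by
  set g : ℝ → ℂ := fun v => (((Ioc (0 : ℝ) 1).indicator f v : ℝ) : ℂ) with hg
  have hgi : Integrable g := by
    rw [intervalIntegrable_iff_integrableOn_Ioc_of_le zero_le_one,
      ← integrable_indicator_iff measurableSet_Ioc] at hf
    exact hf.ofReal
  -- The Fourier character has frequency `2π`, so `α/π` is the frequency whose real part is
  -- `cos(2αs)`.
  have hlim : Tendsto (fun α : ℝ => α / π) atTop (cocompact ℝ) :=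
    (tendsto_id.atTop_div_const pi_pos).mono_right atTop_le_cocompact
  have h := (Complex.continuous_re.tendsto 0).comp
    ((Real.tendsto_integral_exp_smul_cocompact g).comp hlim)
  rw [Complex.zero_re] at h
  refine h.congr fun α => ?_
  have hint : Integrable (fun v : ℝ => Real.fourierChar (-(v * (α / π))) • g v) := by
    have hc : Continuous fun v : ℝ => Real.fourierChar (-(v * (α / π))) :=
      Real.continuous_fourierChar.comp (by fun_prop)
    refine hgi.mono (hc.aestronglyMeasurable.smul hgi.aestronglyMeasurable)
      (Eventually.of_forall fun v => ?_)
    rw [Circle.norm_smul]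
  simp only [Function.comp_apply]
  rw [← Complex.reCLM_apply, ← ContinuousLinearMap.integral_comp_comm _ hint,
    integral_of_le zero_le_one, ← MeasureTheory.integral_indicator measurableSet_Ioc]
  refine integral_congr_ae (Eventually.of_forall fun v => ?_)
  simp only [Complex.reCLM_apply, Circle.smul_def, hg, Real.fourierChar_apply]
  by_cases hv : v ∈ Ioc (0 : ℝ) 1
  · simp only [indicator_of_mem hv, smul_eq_mul, Complex.re_mul_ofReal]
    rw [Complex.exp_ofReal_mul_I_re, mul_comm (f v)]
    congr 1
    rw [← cos_neg]
    congr 1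
    field_simp
  · simp [indicator_of_notMem hv]

/-- The inner integral is an integrable function of `s`, so the Riemann–Lebesgue lemma applies. -/
theorem C3_tendsto {p : ℝ} (hp : 1 < p) : Tendsto (C3 p) atTop (𝓝 0) := by
  set k : ℝ → ℝ := fun y => (1 - y ^ 2) / (1 - y ^ (p + 1)) ^ (5 / 2 : ℝ) with hk
  set ψ : ℝ → ℝ := fun s => ∫ y in (0 : ℝ)..s, k y with hψ
  have hk0 : ∀ y ∈ Ico (0 : ℝ) 1, 0 ≤ k y ∧ k y ≤ (1 - y) ^ (-(3 / 2) : ℝ) := by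
    intro y hy
    have hy' : y ∈ Icc (0 : ℝ) 1 := ⟨hy.1, hy.2.le⟩
    have h1 := gap_pos hp hy
    have h2 := one_sub_sq_le_gap hp hy'
    have h3 := one_sub_le_gap hp hy'
    have h4 : (0 : ℝ) < 1 - y := by linarith [hy.2]
    have h5 : 0 ≤ 1 - y ^ 2 := by nlinarith [hy.1, hy.2]
    have h6 : 0 < gap p y ^ (5 / 2 : ℝ) := rpow_pos_of_pos h1 _
    refine ⟨div_nonneg h5 h6.le, ?_⟩
    simp only [hk]
    rw [← gap]
    calc (1 - y ^ 2) / gap p y ^ (5 / 2 : ℝ) ≤ gap p y / gap p y ^ (5 / 2 : ℝ) := by gcongr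
      _ = gap p y ^ (-(3 / 2) : ℝ) := by
        rw [show (-(3 / 2) : ℝ) = 1 - 5 / 2 by norm_num, rpow_sub h1, rpow_one]
      _ ≤ _ := rpow_le_rpow_of_nonpos h4 h3 (by norm_num)
  have hcont : ContinuousOn k (Ico 0 1) := by
    intro y hy
    have h1 := gap_pos hp hy
    have hc : Continuous fun u : ℝ => u ^ (p + 1) := Real.continuous_rpow_const (by linarith)
    refine ContinuousAt.continuousWithinAt (ContinuousAt.div (by fun_prop) ?_
      (rpow_pos_of_pos h1 _).ne')
    exact (continuousAt_const.sub hc.continuousAt).rpow_const (Or.inl h1.ne')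
  have hint : ∀ a ∈ Ico (0 : ℝ) 1, ∀ b ∈ Ico (0 : ℝ) 1, IntervalIntegrable k volume a b :=
    fun a ha b hb => (hcont.mono (ordConnected_Ico.uIcc_subset ha hb)).intervalIntegrable
  have h00 : (0 : ℝ) ∈ Ico (0 : ℝ) 1 := by simp
  -- The majorant `(1 - y)^{-3/2}` has primitive `2(1 - y)^{-1/2}`, whose singularity at `1` is
  -- integrable.
  have hbound : ∀ s ∈ Ioo (0 : ℝ) 1, |ψ s| ≤ 2 * (1 / √(1 - s)) := by
    intro s hs
    have hsI : s ∈ Ico (0 : ℝ) 1 := ⟨hs.1.le, hs.2⟩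
    have hsub : ∀ y ∈ Icc 0 s, y ∈ Ico (0 : ℝ) 1 := fun y hy => ⟨hy.1, hy.2.trans_lt hs.2⟩
    have hnn : 0 ≤ ψ s := integral_nonneg hs.1.le fun y hy => (hk0 y (hsub y hy)).1
    have hd : ∀ y ∈ uIcc 0 s, HasDerivAt (fun y : ℝ => 2 * (1 - y) ^ (-(1 / 2) : ℝ))
        ((1 - y) ^ (-(3 / 2) : ℝ)) y := by
      intro y hy
      rw [uIcc_of_le hs.1.le] at hy
      have h4 : (0 : ℝ) < 1 - y := by linarith [(hsub y hy).2]
      have := (((hasDerivAt_id y).const_sub 1).rpow_const (p := -(1 / 2))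
        (Or.inl h4.ne')).const_mul 2
      refine this.congr_deriv ?_
      simp only [id]
      rw [show (-(1 / 2) - 1 : ℝ) = -(3 / 2) by norm_num]
      ring
    have hci : IntervalIntegrable (fun y : ℝ => (1 - y) ^ (-(3 / 2) : ℝ)) volume 0 s := by
      refine ContinuousOn.intervalIntegrable fun y hy => ?_
      rw [uIcc_of_le hs.1.le] at hy
      have h4 : (0 : ℝ) < 1 - y := by linarith [(hsub y hy).2]
      exact ((continuousAt_const.sub continuousAt_id).rpow_const
        (Or.inl h4.ne')).continuousWithinAt
    rw [abs_of_nonneg hnn]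
    calc ψ s ≤ ∫ y in (0 : ℝ)..s, (1 - y) ^ (-(3 / 2) : ℝ) :=
          integral_mono_on hs.1.le (hint 0 h00 s hsI) hci fun y hy => (hk0 y (hsub y hy)).2
      _ = 2 * (1 - s) ^ (-(1 / 2) : ℝ) - 2 := by
          rw [integral_eq_sub_of_hasDerivAt hd hci]
          norm_num
      _ ≤ 2 * (1 - s) ^ (-(1 / 2) : ℝ) := by linarith
      _ = _ := by
          rw [rpow_neg (by linarith [hs.2]), ← Real.sqrt_eq_rpow, one_div]
  -- Monotonicity is used to obtain measurability of `ψ`.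
  have hmono : MonotoneOn ψ (Ioo 0 1) := by
    intro a ha b hb hab
    have haI : a ∈ Ico (0 : ℝ) 1 := ⟨ha.1.le, ha.2⟩
    have hbI : b ∈ Ico (0 : ℝ) 1 := ⟨hb.1.le, hb.2⟩
    have h1 : ψ b - ψ a = ∫ y in a..b, k y :=
      integral_interval_sub_left (hint _ h00 _ hbI) (hint _ h00 _ haI)
    have h2 : 0 ≤ ∫ y in a..b, k y := integral_nonneg hab fun y hy =>
      (hk0 y ⟨ha.1.le.trans hy.1, hy.2.trans_lt hb.2⟩).1
    linarith
  have hψi : IntervalIntegrable ψ volume 0 1 :=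
    intervalIntegrable_of_abs_le
      (aemeasurable_restrict_of_monotoneOn measurableSet_Ioo hmono).aestronglyMeasurable hbound
  have := (tendsto_integral_mul_cos hψi).const_mul (-(3 / 32) * (p + 1) ^ 2)
  rw [mul_zero] at this
  exact this

/-! ### Sign changes of `C11` -/

/-- A strictly convex function has a positive cosine coefficient over a full period. -/
theorem integral_mul_cos_period_pos {h : ℝ → ℝ} {a L : ℝ} (hL : 0 < L)
    (hconv : StrictConvexOn ℝ (Ioo a (a + L)) h) (hi : IntervalIntegrable h volume a (a + L)) :
    0 < ∫ s in a..a + L, h s * cos (2 * π / L * (s - a)) := by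
  have hπ := pi_pos
  set w := 2 * π / L with hw
  have hwL : w * L = 2 * π := by rw [hw]; field_simp
  have hw0 : 0 < w := by positivity
  set z₁ := a + L / 4 with hz₁
  set z₂ := a + 3 * L / 4 with hz₂
  have hm₁ : z₁ ∈ Ioo a (a + L) := ⟨by linarith, by linarith⟩
  have hm₂ : z₂ ∈ Ioo a (a + L) := ⟨by linarith, by linarith⟩
  have h12 : z₁ < z₂ := by linarith
  set m := (h z₂ - h z₁) / (z₂ - z₁) with hm
  have hm' : m * (z₂ - z₁) = h z₂ - h z₁ := by
    rw [hm, div_mul_cancel₀ _ (by linarith)]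
  -- The secant of `h` through the two zeros of the cosine. It is orthogonal to the cosine over the
  -- period, and by convexity `h - l` has the sign of the cosine on each of the three pieces.
  set l : ℝ → ℝ := fun s => h z₁ + m * (s - z₁) with hl
  have hlc : Continuous l := by fun_prop
  have hcc : Continuous fun s => cos (w * (s - a)) := by fun_prop
  have hlint : ∫ s in a..a + L, l s * cos (w * (s - a)) = 0 := by
    have hd : ∀ s ∈ uIcc a (a + L), HasDerivAt
        (fun s => l s * sin (w * (s - a)) / w + m * cos (w * (s - a)) / w ^ 2)
        (l s * cos (w * (s - a))) s := by
      intro s _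
      have h1 : HasDerivAt (fun s => w * (s - a)) w s := by
        simpa using ((hasDerivAt_id s).sub_const a).const_mul w
      have h2 : HasDerivAt l m s :=
        ((((hasDerivAt_id s).sub_const z₁).const_mul m).const_add (h z₁)).congr_deriv (mul_one m)
      have h3 := ((h2.mul ((Real.hasDerivAt_sin _).comp s h1)).div_const w).add
        ((((Real.hasDerivAt_cos _).comp s h1).const_mul m).div_const (w ^ 2))
      refine h3.congr_deriv ?_
      simp only [Function.comp_apply]
      field_simp
      ring
    rw [integral_eq_sub_of_hasDerivAt hd ((hlc.mul hcc).intervalIntegrable _ _)]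
    simp [hwL]
  have hil : ∀ c d, c ∈ Icc a (a + L) → d ∈ Icc a (a + L) →
      IntervalIntegrable (fun s => (h s - l s) * cos (w * (s - a))) volume c d := by
    intro c d hc hd
    have : IntervalIntegrable (fun s => (h s - l s) * cos (w * (s - a))) volume a (a + L) :=
      (hi.sub (hlc.intervalIntegrable _ _)).mul_continuousOn hcc.continuousOn
    exact this.mono_set (by
      rw [uIcc_of_le (by linarith : a ≤ a + L)]
      exact ordConnected_Icc.uIcc_subset hc hd)
  have hca : a ∈ Icc a (a + L) := ⟨le_rfl, by linarith⟩
  have hcb : a + L ∈ Icc a (a + L) := ⟨by linarith, le_rfl⟩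
  have hc₁ := Ioo_subset_Icc_self hm₁
  have hc₂ := Ioo_subset_Icc_self hm₂
  have e1 : 0 < ∫ s in a..z₁, (h s - l s) * cos (w * (s - a)) := by
    refine intervalIntegral_pos_of_pos_on (hil _ _ hca hc₁) (fun s hs => ?_) hm₁.1
    have hcv := hconv.slope_strict_mono_adjacent ⟨hs.1, by linarith [hs.2]⟩ hm₂ hs.2 h12
    rw [← hm, div_lt_iff₀ (by linarith [hs.2])] at hcv
    refine mul_pos (by simp only [hl]; linarith) (cos_pos_of_mem_Ioo ⟨?_, ?_⟩)
    · have := mul_pos hw0 (sub_pos.2 hs.1)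
      linarith
    · have : w * (s - a) < w * (L / 4) := mul_lt_mul_of_pos_left (by linarith [hs.2]) hw0
      linarith
  have e2 : 0 < ∫ s in z₁..z₂, (h s - l s) * cos (w * (s - a)) := by
    refine intervalIntegral_pos_of_pos_on (hil _ _ hc₁ hc₂) (fun s hs => ?_) h12
    have hcv := hconv.slope_strict_mono_adjacent hm₁ hm₂ hs.1 hs.2
    rw [div_lt_div_iff₀ (by linarith [hs.1]) (by linarith [hs.2])] at hcv
    refine mul_pos_of_neg_of_neg ?_ (cos_neg_of_pi_div_two_lt_of_lt ?_ ?_)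
    · have h4 : 0 < z₂ - z₁ := by linarith
      have h5 : (h s - l s) * (z₂ - z₁) < 0 := by
        have : (h s - l s) * (z₂ - z₁) =
            (h s - h z₁) * (z₂ - z₁) - m * (z₂ - z₁) * (s - z₁) := by
          simp only [hl]
          ring
        rw [this, hm']
        linarith
      exact neg_of_mul_neg_left h5 h4.le
    · have : w * (L / 4) < w * (s - a) := mul_lt_mul_of_pos_left (by linarith [hs.1]) hw0
      linarith
    · have : w * (s - a) < w * (3 * L / 4) := mul_lt_mul_of_pos_left (by linarith [hs.2]) hw0
      linarith
  have e3 : 0 < ∫ s in z₂..a + L, (h s - l s) * cos (w * (s - a)) := by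
    refine intervalIntegral_pos_of_pos_on (hil _ _ hc₂ hcb) (fun s hs => ?_) hm₂.2
    have hcv := hconv.slope_strict_mono_adjacent hm₁ ⟨by linarith [hs.1], hs.2⟩ h12 hs.1
    rw [← hm, lt_div_iff₀ (by linarith [hs.1])] at hcv
    have h4 : l s = h z₂ + m * (s - z₂) := by
      simp only [hl]
      linear_combination hm'
    rw [← cos_two_pi_sub]
    refine mul_pos (by linarith) (cos_pos_of_mem_Ioo ⟨?_, ?_⟩)
    · have : w * (s - a) < w * L := mul_lt_mul_of_pos_left (by linarith [hs.2]) hw0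
      linarith
    · have : w * (3 * L / 4) < w * (s - a) := mul_lt_mul_of_pos_left (by linarith [hs.1]) hw0
      linarith
  have hsum : ∫ s in a..a + L, h s * cos (w * (s - a)) =
      ∫ s in a..a + L, (h s - l s) * cos (w * (s - a)) := by
    simp only [sub_mul]
    rw [intervalIntegral.integral_sub (hi.mul_continuousOn hcc.continuousOn)
      ((show Continuous fun s => l s * cos (w * (s - a)) from
        hlc.mul hcc).intervalIntegrable _ _), hlint, sub_zero]
  rw [hsum, ← integral_add_adjacent_intervals (hil _ _ hca hc₂) (hil _ _ hc₂ hcb),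
    ← integral_add_adjacent_intervals (hil _ _ hca hc₁) (hil _ _ hc₁ hc₂)]
  linarith

/-- Each period contributes positively. The count `N + 1` ensures at least one period. -/
theorem integral_mul_cos_periods_pos {h : ℝ → ℝ} {a L : ℝ} (hL : 0 < L) (N : ℕ)
    (hconv : StrictConvexOn ℝ (Ioo a (a + (N + 1 : ℕ) * L)) h)
    (hi : IntervalIntegrable h volume a (a + (N + 1 : ℕ) * L)) :
    0 < ∫ s in a..a + (N + 1 : ℕ) * L, h s * cos (2 * π / L * (s - a)) := by
  induction N with
  | zero =>
    simp only [zero_add, Nat.cast_one, one_mul] at hconv hi ⊢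
    exact integral_mul_cos_period_pos hL hconv hi
  | succ N ih =>
    set b := a + (N + 1 : ℕ) * L with hb
    have hbL : a + (N + 1 + 1 : ℕ) * L = b + L := by
      rw [hb]
      push_cast
      ring
    rw [hbL] at hconv hi ⊢
    have hab : a ≤ b := by
      have : (0 : ℝ) ≤ (N + 1 : ℕ) * L := by positivity
      linarith
    have hbI : b ∈ uIcc a (b + L) := by
      rw [uIcc_of_le (by linarith)]
      exact ⟨hab, by linarith⟩
    have hi1 : IntervalIntegrable h volume a b :=
      hi.mono_set (uIcc_subset_uIcc left_mem_uIcc hbI)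
    have hi2 : IntervalIntegrable h volume b (b + L) :=
      hi.mono_set (uIcc_subset_uIcc hbI right_mem_uIcc)
    have h1 := ih (hconv.subset (Ioo_subset_Ioo_right (by linarith)) (convex_Ioo _ _)) hi1
    have h2 := integral_mul_cos_period_pos hL
      (hconv.subset (Ioo_subset_Ioo_left hab) (convex_Ioo _ _)) hi2
    have hc : ∀ s, cos (2 * π / L * (s - b)) = cos (2 * π / L * (s - a)) := by
      intro s
      rw [← cos_add_nat_mul_two_pi _ (N + 1)]
      congr 1
      rw [hb]
      field_simp
      ring
    simp only [hc] at h2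
    have hcc : Continuous fun s => cos (2 * π / L * (s - a)) := by fun_prop
    rw [← integral_add_adjacent_intervals (hi1.mul_continuousOn hcc.continuousOn)
      (hi2.mul_continuousOn hcc.continuousOn)]
    linarith

/-- The midpoint value `K` integrates to zero against the cosine, and `K - h` changes sign exactly
where the cosine does. -/
theorem integral_mul_cos_half_period_neg {h : ℝ → ℝ} {c : ℝ} (hc : 0 < c)
    (hmono : StrictMonoOn h (Ioo 0 c)) (hi : IntervalIntegrable h volume 0 c) :
    ∫ s in (0 : ℝ)..c, h s * cos (π / c * s) < 0 := by
  have hπ := pi_pos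
  set w := π / c with hw
  have hwc : w * c = π := by rw [hw]; field_simp
  have hw0 : 0 < w := by positivity
  have hcc : Continuous fun s => cos (w * s) := by fun_prop
  set K := h (c / 2) with hK
  have hcm : c / 2 ∈ Ioo 0 c := ⟨by linarith, by linarith⟩
  have hKint : ∫ s in (0 : ℝ)..c, K * cos (w * s) = 0 := by
    rw [intervalIntegral.integral_const_mul, integral_comp_mul_left _ hw0.ne', integral_cos]
    simp [hwc]
  have hil : ∀ a ∈ Icc 0 c, ∀ b ∈ Icc 0 c,
      IntervalIntegrable (fun s => (K - h s) * cos (w * s)) volume a b := by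
    intro a ha b hb
    have : IntervalIntegrable (fun s => (K - h s) * cos (w * s)) volume 0 c :=
      (intervalIntegrable_const.sub hi).mul_continuousOn hcc.continuousOn
    exact this.mono_set (by
      rw [uIcc_of_le hc.le]
      exact ordConnected_Icc.uIcc_subset ha hb)
  have h0 : (0 : ℝ) ∈ Icc 0 c := ⟨le_rfl, hc.le⟩
  have h1 : c ∈ Icc 0 c := ⟨hc.le, le_rfl⟩
  have hm := Ioo_subset_Icc_self hcm
  have e1 : 0 < ∫ s in (0 : ℝ)..(c / 2), (K - h s) * cos (w * s) := by
    refine intervalIntegral_pos_of_pos_on (hil _ h0 _ hm) (fun s hs => ?_) hcm.1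
    have := hmono ⟨hs.1, by linarith [hs.2]⟩ hcm hs.2
    refine mul_pos (by linarith) (cos_pos_of_mem_Ioo ⟨?_, ?_⟩)
    · have := mul_pos hw0 hs.1
      linarith
    · have : w * s < w * (c / 2) := mul_lt_mul_of_pos_left hs.2 hw0
      linarith
  have e2 : 0 < ∫ s in (c / 2)..c, (K - h s) * cos (w * s) := by
    refine intervalIntegral_pos_of_pos_on (hil _ hm _ h1) (fun s hs => ?_) hcm.2
    have := hmono hcm ⟨by linarith [hs.1], hs.2⟩ hs.1
    refine mul_pos_of_neg_of_neg (by linarith) (cos_neg_of_pi_div_two_lt_of_lt ?_ ?_)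
    · have : w * (c / 2) < w * s := mul_lt_mul_of_pos_left hs.1 hw0
      linarith
    · have : w * s < w * c := mul_lt_mul_of_pos_left hs.2 hw0
      linarith
  have e3 := integral_add_adjacent_intervals (hil _ h0 _ hm) (hil _ hm _ h1)
  have e4 : ∫ s in (0 : ℝ)..c, (K - h s) * cos (w * s) =
      -∫ s in (0 : ℝ)..c, h s * cos (w * s) := by
    simp only [sub_mul]
    rw [intervalIntegral.integral_sub ((hcc.const_mul K).intervalIntegrable _ _)
      (hi.mul_continuousOn hcc.continuousOn), hKint, zero_sub]
  linarith

/-- The weight of the oscillatory integral `C11`. -/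
def weight (p s : ℝ) : ℝ := s / √(gap p s)

theorem C11_eq_weight {p : ℝ} (hp : 1 < p) (α : ℝ) :
    C11 p α = ∫ s in (0 : ℝ)..1, weight p s * cos (2 * α * s) := by
  rw [C11_eq hp, gapInt]
  refine integral_congr fun s _ => ?_
  simp only [weight, pow_zero, one_mul]
  ring

theorem weight_integrable {p : ℝ} (hp : 1 < p) : IntervalIntegrable (weight p) volume 0 1 := by
  have := (gapBounded_zero (C := 1) (p := p) (φ := fun s => s) measurable_id fun s hs => by
    rw [abs_of_pos hs.1]
    exact hs.2.le).intervalIntegrable hp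
  simpa only [pow_zero, one_mul] using! this

theorem gap_strictAnti {p s t : ℝ} (hp : 1 < p) (hs : 0 ≤ s) (hst : s < t) :
    gap p t < gap p s := by
  have := rpow_lt_rpow hs hst (by linarith : 0 < p + 1)
  unfold gap
  linarith

theorem weight_strictMonoOn {p : ℝ} (hp : 1 < p) : StrictMonoOn (weight p) (Ioo 0 1) := by
  intro s hs t ht hst
  have h1 := gap_strictAnti hp hs.1.le hst
  have h2 := sqrt_gap_pos hp ht
  have h3 : √(gap p t) ≤ √(gap p s) := Real.sqrt_le_sqrt h1.le
  unfold weight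
  rw [div_lt_div_iff₀ (h2.trans_le h3) h2]
  calc s * √(gap p t) < t * √(gap p t) := mul_lt_mul_of_pos_right hst h2
    _ ≤ _ := mul_le_mul_of_nonneg_left h3 ht.1.le

theorem weight_hasDerivAt {p s : ℝ} (hp : 1 < p) (hs : s ∈ Ioo (0 : ℝ) 1) :
    HasDerivAt (weight p)
      (1 / √(gap p s) + (p + 1) / 2 * (s ^ (p + 1) / (gap p s * √(gap p s)))) s := by
  have hg := gap_pos hp ⟨hs.1.le, hs.2⟩
  have hsg := sqrt_gap_pos hp hs
  have h1 : HasDerivAt (gap p) (-((p + 1) * s ^ p)) s := by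
    have := (Real.hasDerivAt_rpow_const (x := s) (p := p + 1) (Or.inl hs.1.ne')).const_sub 1
    rwa [add_sub_cancel_right] at this
  refine ((hasDerivAt_id s).div (h1.sqrt hg.ne') hsg.ne').congr_deriv ?_
  have h3 : s ^ (p + 1) = s ^ p * s := by rw [rpow_add hs.1, rpow_one]
  have h4 : √(gap p s) ^ 2 = gap p s := Real.sq_sqrt hg.le
  simp only [id]
  rw [h3, h4]
  field_simp
  rw [h4]
  ring

/-- Both summands of the derivative are nondecreasing, and the first, `1/√gap`, strictly increases.
-/
theorem weight_strictConvexOn {p : ℝ} (hp : 1 < p) :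
    StrictConvexOn ℝ (Ioo 0 1) (weight p) := by
  refine StrictMonoOn.strictConvexOn_of_deriv (convex_Ioo 0 1)
    (fun s hs => (weight_hasDerivAt hp hs).continuousAt.continuousWithinAt) ?_
  rw [interior_Ioo]
  intro s hs t ht hst
  rw [(weight_hasDerivAt hp hs).deriv, (weight_hasDerivAt hp ht).deriv]
  have h1 := gap_strictAnti hp hs.1.le hst
  have h2 := gap_pos hp ⟨ht.1.le, ht.2⟩
  have h3 := sqrt_gap_pos hp ht
  have h4 : √(gap p t) < √(gap p s) := Real.sqrt_lt_sqrt h2.le h1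
  have h5 : s ^ (p + 1) ≤ t ^ (p + 1) := rpow_le_rpow hs.1.le hst.le (by linarith)
  have h6 : 0 ≤ t ^ (p + 1) := rpow_nonneg ht.1.le _
  have h7 : 0 < p + 1 := by linarith
  have h0 : 0 ≤ gap p s := (h2.trans h1).le
  have h8 : 1 / √(gap p s) < 1 / √(gap p t) := one_div_lt_one_div_of_lt h3 h4
  have h9 : (p + 1) / 2 * (s ^ (p + 1) / (gap p s * √(gap p s))) ≤
      (p + 1) / 2 * (t ^ (p + 1) / (gap p t * √(gap p t))) := by
    gcongr
  linarith

/-- At `α = (n+1)π` the interval holds exactly `n + 1` periods of `cos(2αs)`. -/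
theorem C11_pos {p : ℝ} (hp : 1 < p) (n : ℕ) : 0 < C11 p ((n + 1 : ℕ) * π) := by
  have hn : (0 : ℝ) < (n + 1 : ℕ) := by positivity
  have hN : (0 : ℝ) + (n + 1 : ℕ) * (1 / (n + 1 : ℕ)) = 1 := by
    rw [zero_add, mul_one_div, div_self hn.ne']
  have := integral_mul_cos_periods_pos (h := weight p) (a := 0) (L := 1 / (n + 1 : ℕ))
    (by positivity) n (by rw [hN]; exact weight_strictConvexOn hp)
    (by rw [hN]; exact weight_integrable hp)
  rw [hN] at this
  rw [C11_eq_weight hp]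
  convert this using 5
  simp only [sub_zero]
  field_simp

theorem C11_neg {p : ℝ} (hp : 1 < p) (n : ℕ) :
    C11 p ((n + 1 : ℕ) * π + π / 2) < 0 := by
  -- Here `2α = Dπ`: the interval splits into a half period of length `1/D` and `n + 1` periods of
  -- length `2/D` starting at a trough, where the shifted cosine has the opposite sign.
  set D : ℝ := 2 * (n + 1 : ℕ) + 1 with hD
  have hD0 : 0 < D := by positivity
  have hD1 : 1 / D < 1 := by
    rw [div_lt_one hD0, hD]
    have : (0 : ℝ) < (n + 1 : ℕ) := by positivity
    linarith
  have hc0 : 0 < 1 / D := by positivity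
  have hN : 1 / D + (n + 1 : ℕ) * (2 / D) = 1 := by
    rw [hD]
    field_simp
    ring
  have hcI : 1 / D ∈ uIcc (0 : ℝ) 1 := by
    rw [uIcc_of_le zero_le_one]
    exact ⟨hc0.le, hD1.le⟩
  have hi1 := (weight_integrable hp).mono_set (uIcc_subset_uIcc left_mem_uIcc hcI)
  have hi2 := (weight_integrable hp).mono_set (uIcc_subset_uIcc hcI right_mem_uIcc)
  have e1 := integral_mul_cos_half_period_neg hc0
    ((weight_strictMonoOn hp).mono (Ioo_subset_Ioo_right hD1.le)) hi1
  have e2 := integral_mul_cos_periods_pos (h := weight p) (a := 1 / D) (L := 2 / D)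
    (by positivity) n
    (by
      rw [hN]
      exact (weight_strictConvexOn hp).subset (Ioo_subset_Ioo_left hc0.le) (convex_Ioo _ _))
    (by rw [hN]; exact hi2)
  rw [hN] at e2
  have hcos : ∀ s, cos (2 * π / (2 / D) * (s - 1 / D)) = -cos (π / (1 / D) * s) := by
    intro s
    rw [← cos_sub_pi]
    congr 1
    field_simp
  simp only [hcos, mul_neg, intervalIntegral.integral_neg] at e2
  have hα : ∀ s, 2 * ((n + 1 : ℕ) * π + π / 2) * s = π / (1 / D) * s := by
    intro s
    rw [hD]
    field_simp
  have hcc : Continuous fun s => cos (π / (1 / D) * s) := by fun_prop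
  rw [C11_eq_weight hp]
  simp only [hα]
  rw [← integral_add_adjacent_intervals (hi1.mul_continuousOn hcc.continuousOn)
    (hi2.mul_continuousOn hcc.continuousOn)]
  linarith

theorem tendsto_succ_mul_pi (c : ℝ) :
    Tendsto (fun n : ℕ => ((n + 1 : ℕ) : ℝ) * π + c) atTop atTop :=
  tendsto_atTop_add_const_right _ _
    ((tendsto_natCast_atTop_atTop.comp (tendsto_add_atTop_nat 1)).atTop_mul_const pi_pos)

theorem C11_frequently_pos {p : ℝ} (hp : 1 < p) : ∃ᶠ α in atTop, 0 < C11 p α :=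
  (tendsto_succ_mul_pi 0).frequently
    (Frequently.of_forall fun n => by simpa only [add_zero] using C11_pos hp n)

theorem C11_frequently_neg {p : ℝ} (hp : 1 < p) : ∃ᶠ α in atTop, C11 p α < 0 :=
  (tendsto_succ_mul_pi (π / 2)).frequently (Frequently.of_forall fun n => C11_neg hp n)

/-! ### Bounded and vanishing coefficients, assembled expansions -/

/-- `f(α)` is bounded as `α → ∞`. -/
def IsBdd (f : ℝ → ℝ) : Prop := f =O[atTop] fun _ => (1 : ℝ)

/-- `f(α) → 0` as `α → ∞`. -/
def IsNull (f : ℝ → ℝ) : Prop := f =o[atTop] fun _ => (1 : ℝ)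

theorem isBdd_const (c : ℝ) : IsBdd fun _ => c := isBigO_const_const c one_ne_zero _

theorem isBdd_of_abs_le {f : ℝ → ℝ} {C : ℝ} (h : ∀ α, |f α| ≤ C) : IsBdd f :=
  IsBigO.of_bound C (Eventually.of_forall fun α => by simpa using h α)

theorem isNull_iff {f : ℝ → ℝ} : IsNull f ↔ Tendsto f atTop (𝓝 0) := isLittleO_one_iff ℝ

theorem IsNull.isBdd {f : ℝ → ℝ} (h : IsNull f) : IsBdd f := h.isBigO

theorem IsBdd.add {f g : ℝ → ℝ} (hf : IsBdd f) (hg : IsBdd g) : IsBdd fun α => f α + g α :=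
  IsBigO.add hf hg

theorem IsBdd.mul {f g : ℝ → ℝ} (hf : IsBdd f) (hg : IsBdd g) : IsBdd fun α => f α * g α := by
  simpa [IsBdd] using! IsBigO.mul hf hg

theorem IsNull.add {f g : ℝ → ℝ} (hf : IsNull f) (hg : IsNull g) : IsNull fun α => f α + g α :=
  IsLittleO.add hf hg

theorem IsNull.sub {f g : ℝ → ℝ} (hf : IsNull f) (hg : IsNull g) : IsNull fun α => f α - g α :=
  IsLittleO.sub hf hg

theorem IsNull.mul_isBdd {f g : ℝ → ℝ} (hf : IsNull f) (hg : IsBdd g) :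
    IsNull fun α => f α * g α := by
  simpa [IsNull] using! IsLittleO.mul_isBigO hf hg

theorem IsNull.mul_isLittleO {f r g : ℝ → ℝ} (hf : IsNull f)
    (h : ∀ᶠ α in atTop, r α = g α * f α) : r =o[atTop] g := by
  have : (fun α => g α * f α) =o[atTop] g := by
    simpa using! IsBigO.mul_isLittleO (isBigO_refl g atTop) hf
  exact this.congr' (h.mono fun _ h => h.symm) EventuallyEq.rfl

theorem isNull_inv : IsNull fun α => α⁻¹ := isNull_iff.2 tendsto_inv_atTop_zero

theorem isNull_rpow {q : ℝ} (hq : q < 0) : IsNull fun α => α ^ q := by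
  have := tendsto_rpow_neg_atTop (y := -q) (by linarith)
  rw [neg_neg] at this
  exact isNull_iff.2 this

section coefficients

variable {p : ℝ}

theorem isBdd_gapInt_zero (hp : 1 < p) {φ : ℝ → ℝ → ℝ} {C : ℝ}
    (h : ∀ α, ∀ s ∈ Ioo (0 : ℝ) 1, |φ α s| ≤ C) : IsBdd fun α => gapInt p 0 (φ α) :=
  isBdd_of_abs_le (C := C * C0 p) fun α => abs_gapInt_le hp fun s hs => by
    simpa using h α s hs

theorem abs_mul_le_one {s x : ℝ} (hs : s ∈ Ioo (0 : ℝ) 1) (hx : |x| ≤ 1) : |s * x| ≤ 1 := by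
  rw [abs_mul, abs_of_pos hs.1]
  exact mul_le_one₀ hs.2.le (abs_nonneg _) hx

theorem abs_sub_le_two {x y : ℝ} (hx : |x| ≤ 1) (hy : |y| ≤ 1) : |x - y| ≤ 2 :=
  (abs_sub _ _).trans (by linarith)

theorem isBdd_C11 (hp : 1 < p) : IsBdd (C11 p) := by
  rw [funext (C11_eq hp)]
  exact isBdd_gapInt_zero hp fun α s hs => abs_mul_le_one hs (abs_cos_le_one _)

theorem isBdd_C21 (hp : 1 < p) : IsBdd (C21 p) := by
  rw [funext (C21_eq hp)]
  exact (isBdd_const _).mul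
    (isBdd_gapInt_zero hp fun α s hs => abs_mul_le_one hs (abs_sin_le_one _))

theorem isBdd_C22 (hp : 1 < p) : IsBdd (C22 p) := by
  rw [funext (C22_eq hp)]
  exact (isBdd_const _).mul
    (isBdd_gapInt_zero hp fun α s _ => abs_sub_le_two (abs_cos_le_one _) (abs_cos_le_one _))

theorem isBdd_E3 (hp : 1 < p) : IsBdd (E3 p) := by
  rw [funext (E3_eq hp)]
  exact (isBdd_const _).mul
    (isBdd_gapInt_zero hp fun α s _ => abs_sub_le_two (abs_cos_le_one _) (abs_cos_le_one _))

theorem isBdd_E2 (hp : 1 < p) : IsBdd (E2 p) := by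
  rw [funext (E2_eq hp)]
  exact (isBdd_const _).mul (isBdd_gapInt_zero hp fun α s hs =>
    abs_sub_le_two (abs_sin_le_one _) (abs_mul_le_one hs (abs_sin_le_one _)))

theorem isBdd_C12 (hp : 1 < p) : IsBdd (C12 p) := by
  rw [funext (C12_eq hp)]
  refine ((isBdd_const _).mul (isBdd_gapInt_zero hp fun α s _ =>
    abs_sub_le_two (abs_sin_le_one _) (abs_sin_le_one _))).add ((isBdd_const _).mul
    (isBdd_of_abs_le (C := 1 * C0 p) fun α => abs_gapInt_le hp fun s hs => ?_))
  rw [abs_mul, abs_of_pos (by linarith [hs.2] : 0 < 1 - s), pow_one, one_mul]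
  exact (mul_le_of_le_one_right (by linarith [hs.2]) (abs_sin_le_one _)).trans
    (one_sub_le_gap hp (Ioo_subset_Icc_self hs))

theorem isNull_C3 (hp : 1 < p) : IsNull (C3 p) := isNull_iff.2 (C3_tendsto hp)

end coefficients

/-- If the cubic Taylor remainder is `O(x³)` and the quadratic coefficient converges, then the
total remainder is `o(x²)`. -/
theorem isNull_remainder {f x g : ℝ → ℝ} {K L : ℝ} (hx : ∀ α, 0 < α → 0 < x α) (hx0 : IsNull x)
    (hf : ∀ α, 0 < α → |f α - x α ^ 2 * g α| ≤ K * x α ^ 3)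
    (hg : Tendsto g atTop (𝓝 L)) : IsNull fun α => f α / x α ^ 2 - L := by
  have h1 : Tendsto (fun α => f α / x α ^ 2 - g α) atTop (𝓝 0) := by
    have h0 : Tendsto (fun α => K * x α) atTop (𝓝 0) := by
      simpa using (isNull_iff.1 hx0).const_mul K
    refine squeeze_zero_norm' ?_ h0
    filter_upwards [eventually_gt_atTop 0] with α hα
    have hxp := hx α hα
    rw [show f α / x α ^ 2 - g α = (f α - x α ^ 2 * g α) / x α ^ 2 by field_simp,
      Real.norm_eq_abs, abs_div, abs_of_pos (by positivity : 0 < x α ^ 2),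
      div_le_iff₀ (by positivity)]
    exact (hf α hα).trans (le_of_eq (by ring))
  have h2 := h1.add (hg.sub_const L)
  rw [sub_self, add_zero] at h2
  refine isNull_iff.2 (h2.congr fun α => ?_)
  ring

/-- An exact identity valid in every regime of `p`: `t` is the total remainder divided by
`α^{2(1-p)}`, minus its limit `C2`. -/
theorem normTime_eq {p : ℝ} (hp : 1 < p) : ∃ t, IsNull t ∧ ∀ α, 0 < α →
    normTime p α = C0 p + α ^ (1 - p) * (C1 p + 1 / 2 * C11 p α +
      1 / 2 * (C12 p α + C21 p α) * α⁻¹ + 1 / 2 * C22 p α * α⁻¹ ^ 2) +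
      (α ^ (1 - p)) ^ 2 * (C2 p + t α) := by
  set f : ℝ → ℝ := fun α => normTime p α - (C0 p + α ^ (1 - p) * (C1 p + 1 / 2 * C11 p α +
      1 / 2 * (C12 p α + C21 p α) * α⁻¹ + 1 / 2 * C22 p α * α⁻¹ ^ 2)) with hf
  have hx : ∀ α : ℝ, 0 < α → 0 < α ^ (1 - p) := fun α hα => rpow_pos_of_pos hα _
  have hg := (tendsto_gapInt_sq hp le_rfl).const_mul (3 * (p + 1) ^ 2 / 128)
  rw [← C2_eq hp] at hg
  refine ⟨_, isNull_remainder (f := f) (K := ((p + 1) / 2) ^ 3 * C0 p) hx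
    (isNull_rpow (by linarith)) (fun α hα => ?_) hg, fun α hα => ?_⟩
  · have h1 := normTime_expansion hp hα
    have h2 := gapInt_one_pert hp hα
    have h3 := gapInt_pert_sq (p := p) 2 hα
    refine (le_of_eq ?_).trans (h1.trans (le_of_eq ?_))
    · congr 1
      rw [h3]
      simp only [hf, div_eq_mul_inv, inv_pow] at h2 ⊢
      linear_combination h2
    · ring
  · have := hx α hα
    rw [add_sub_cancel, mul_div_cancel₀ _ (by positivity)]
    simp only [hf]
    ring

theorem normVel_eq {p : ℝ} (hp : 1 < p) : ∃ t, IsNull t ∧ ∀ α, 0 < α →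
    normVel p α = E0 p + α ^ (1 - p) * (E1 p + E2 p α * α⁻¹ + E3 p α * α⁻¹ ^ 2) +
      (α ^ (1 - p)) ^ 2 * (E4 p + t α) := by
  set f : ℝ → ℝ := fun α => normVel p α - (E0 p + α ^ (1 - p) * (E1 p +
      E2 p α * α⁻¹ + E3 p α * α⁻¹ ^ 2)) with hf
  have hx : ∀ α : ℝ, 0 < α → 0 < α ^ (1 - p) := fun α hα => rpow_pos_of_pos hα _
  have hg := (tendsto_gapInt_sq (n := 1) hp (by norm_num)).const_mul (-((p + 1) ^ 2 / 128))
  rw [← E4_eq hp] at hg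
  refine ⟨_, isNull_remainder (f := f) (K := ((p + 1) / 2) ^ 3 * C0 p) hx
    (isNull_rpow (by linarith)) (fun α hα => ?_) hg, fun α hα => ?_⟩
  · have h1 := normVel_expansion hp hα
    have h2 := gapInt_zero_pert hp hα
    have h3 := gapInt_pert_sq (p := p) 1 hα
    refine (le_of_eq ?_).trans (h1.trans (le_of_eq ?_))
    · congr 1
      rw [h3]
      simp only [hf, div_eq_mul_inv, inv_pow] at h2 ⊢
      linear_combination h2
    · ring
  · have := hx α hα
    rw [add_sub_cancel, mul_div_cancel₀ _ (by positivity)]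
    simp only [hf]
    ring

theorem normTime_mul_normVel_eq {p : ℝ} (hp : 1 < p) : ∃ h, IsNull h ∧ ∀ α, 0 < α →
    normTime p α * normVel p α = G0 p + α ^ (1 - p) * (G1 p α + G2 p α * α⁻¹ +
      G3 p α * α⁻¹ ^ 2) + (α ^ (1 - p)) ^ 2 * (G4 p α + h α) := by
  obtain ⟨t, ht, hT⟩ := normTime_eq hp
  obtain ⟨t', ht', hM⟩ := normVel_eq hp
  set a : ℝ → ℝ := fun α => C1 p + 1 / 2 * C11 p α with ha
  set c : ℝ → ℝ := fun α => 1 / 2 * (C12 p α + C21 p α) + 1 / 2 * C22 p α * α⁻¹ with hc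
  set e : ℝ → ℝ := fun α => E2 p α + E3 p α * α⁻¹ with he
  have hinv := isNull_inv
  have hx : IsNull fun α => α ^ (1 - p) := isNull_rpow (by linarith)
  have hab : IsBdd a := (isBdd_const _).add ((isBdd_const _).mul (isBdd_C11 hp))
  have hcb : IsBdd c := ((isBdd_const _).mul ((isBdd_C12 hp).add (isBdd_C21 hp))).add
    (((isBdd_const _).mul (isBdd_C22 hp)).mul hinv.isBdd)
  have heb : IsBdd e := (isBdd_E2 hp).add ((isBdd_E3 hp).mul hinv.isBdd)
  have hA : IsBdd fun α => a α + c α * α⁻¹ := hab.add (hcb.mul hinv.isBdd)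
  have hA' : IsBdd fun α => E1 p + e α * α⁻¹ := (isBdd_const _).add (heb.mul hinv.isBdd)
  have hB : IsBdd fun α => C2 p + t α := (isBdd_const _).add ht.isBdd
  have hB' : IsBdd fun α => E4 p + t' α := (isBdd_const _).add ht'.isBdd
  -- All of the product that `G0` to `G4` do not account for, divided by `α^{2(1-p)}`. The term
  -- `-C3` compensates the `C3` inside `G4` and is null.
  refine ⟨fun α => t' α * C0 p + (t α - C3 p α) * E0 p +
    α⁻¹ * (c α * (E1 p + e α * α⁻¹) + a α * e α) +
    α ^ (1 - p) * ((a α + c α * α⁻¹) * (E4 p + t' α) + (C2 p + t α) * (E1 p + e α * α⁻¹) +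
      α ^ (1 - p) * ((C2 p + t α) * (E4 p + t' α))), ?_, fun α hα => ?_⟩
  · exact (((ht'.mul_isBdd (isBdd_const _)).add
      ((ht.sub (isNull_C3 hp)).mul_isBdd (isBdd_const _))).add
      (hinv.mul_isBdd ((hcb.mul hA').add (hab.mul heb)))).add
      (hx.mul_isBdd (((hA.mul hB').add (hB.mul hA')).add (hx.isBdd.mul (hB.mul hB'))))
  · rw [hT α hα, hM α hα, G0, G1, G2, G3, G4]
    simp only [ha, hc, he]
    ring

theorem E0_pos {p : ℝ} (hp : 1 < p) : 0 < E0 p := by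
  have hc : Continuous (gap p) := by
    unfold gap
    have : Continuous fun u : ℝ => u ^ (p + 1) := Real.continuous_rpow_const (by linarith)
    fun_prop
  exact intervalIntegral_pos_of_pos_on (hc.sqrt.intervalIntegrable 0 1)
    (fun s hs => sqrt_gap_pos hp hs) one_pos

theorem G0_pos {p : ℝ} (hp : 1 < p) : 0 < G0 p := mul_pos (C0_pos hp) (E0_pos hp)

theorem rpow_neg_eq {p α : ℝ} (hα : 0 < α) : α ^ (-p) = α ^ (1 - p) * α⁻¹ := by
  rw [show -p = 1 - p + -1 by ring, rpow_add hα, rpow_neg_one]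

theorem rpow_neg_add_one_eq {p α : ℝ} (hα : 0 < α) :
    α ^ (-(p + 1)) = α ^ (1 - p) * α⁻¹ ^ 2 := by
  rw [show -(p + 1) = 1 - p + -1 + -1 by ring, rpow_add hα, rpow_add hα, rpow_neg_one]
  ring

theorem rpow_two_mul_eq {p α : ℝ} (hα : 0 < α) : α ^ (2 * (1 - p)) = (α ^ (1 - p)) ^ 2 := by
  rw [mul_comm, rpow_mul hα.le, rpow_two]

end Kirchhoff

end

/-! ### The theorem: sorting the powers of `α` in each regime -/

open Kirchhoff
theorem theorem1p6 (b p : ℝ) (hb : 0 < b) (hp : 1 < p) :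
    ∃ (lam mu : ℝ → ℝ) (v : ℝ → ℝ → ℝ),
      -- for every `α > 0`: the unique solution pairs for `b = 0` and for the given `b > 0`
      (∀ α : ℝ, 0 < α →
        IsUniqueSolutionPair 0 p α (mu α) (v α) ∧
        IsUniqueSolutionPair b p α (lam α) (v α) ∧
        lam α = (b * energy (v α) + 1) * mu α) ∧
      -- (i)
      (2 < p → ∃ r₁ r₂ : ℝ → ℝ,
        r₁ =o[atTop] (fun α : ℝ => α ^ (2 * (1 - p))) ∧
        r₂ =o[atTop] (fun α : ℝ => α ^ (2 * (1 - p))) ∧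
        ∀ᶠ α in atTop, lam α =
          2 * (p + 1) * α ^ (1 - p) *
            (C0 p + (C1 p + 1 / 2 * C11 p α) * α ^ (1 - p)
              + 1 / 2 * (C12 p α + C21 p α) * α ^ (-p)
              + 1 / 2 * C22 p α * α ^ (-(p + 1))
              + C2 p * α ^ (2 * (1 - p)) + r₁ α) ^ 2 *
            (4 * b * α ^ 2 *
              (G0 p + G1 p α * α ^ (1 - p) + G2 p α * α ^ (-p) + G3 p α * α ^ (-(p + 1))
                + G4 p α * α ^ (2 * (1 - p)) + r₂ α) + 1)) ∧
      -- (ii)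
      (p = 2 → ∃ r₁ r₂ : ℝ → ℝ,
        r₁ =o[atTop] (fun α : ℝ => α ^ (-2 : ℝ)) ∧
        r₂ =o[atTop] (fun α : ℝ => α ^ (-2 : ℝ)) ∧
        ∀ᶠ α in atTop, lam α =
          6 * α ^ (-1 : ℝ) *
            (C0 p + (C1 p + 1 / 2 * C11 p α) * α ^ (-1 : ℝ)
              + (1 / 2 * C12 p α + 1 / 2 * C21 p α + C2 p + C3 p α) * α ^ (-2 : ℝ)
              + r₁ α) ^ 2 *
            (4 * b * α ^ 2 *
              (G0 p + G1 p α * α ^ (-1 : ℝ) + (G2 p α + G4 p α) * α ^ (-2 : ℝ) + r₂ α) + 1)) ∧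
      -- (iii)
      (p < 2 → ∃ r₁ r₂ : ℝ → ℝ,
        r₁ =o[atTop] (fun α : ℝ => α ^ (2 * (1 - p))) ∧
        r₂ =o[atTop] (fun α : ℝ => α ^ (2 * (1 - p))) ∧
        ∀ᶠ α in atTop, lam α =
          2 * (p + 1) * α ^ (1 - p) *
            (C0 p + (C1 p + 1 / 2 * C11 p α) * α ^ (1 - p)
              + C2 p * α ^ (2 * (1 - p)) + r₁ α) ^ 2 *
            (4 * b * α ^ 2 *
              (G0 p + G1 p α * α ^ (1 - p) + G4 p α * α ^ (2 * (1 - p)) + r₂ α) + 1)) ∧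
      -- `lam α ~ α ^ (3 - p)`, with the positive constant made explicit
      0 < 8 * b * (p + 1) * C0 p ^ 2 * G0 p ∧
      Tendsto (fun α => lam α / α ^ (3 - p)) atTop (𝓝 (8 * b * (p + 1) * C0 p ^ 2 * G0 p)) ∧
      -- the coefficient `C11` in the second term oscillates as `α → ∞`
      (∃ᶠ α in atTop, 0 < C11 p α) ∧ (∃ᶠ α in atTop, C11 p α < 0) := by
  obtain ⟨t, ht, hT⟩ := normTime_eq hp
  obtain ⟨h, hh, hTM⟩ := normTime_mul_normVel_eq hp
  have hform : ∀ α : ℝ, 0 < α → (b * (4 * α ^ 2 * (normTime p α * normVel p α)) + 1) *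
      (2 * (p + 1) * α ^ (1 - p) * normTime p α ^ 2) =
      2 * (p + 1) * α ^ (1 - p) * normTime p α ^ 2 *
        (4 * b * α ^ 2 * (normTime p α * normVel p α) + 1) := fun α _ => by ring
  have hα0 : ∀ᶠ α : ℝ in atTop, 0 < α := eventually_gt_atTop 0
  have hinv := isNull_inv
  have hG2 : IsBdd (G2 p) := ((((isBdd_const _).mul ((isBdd_C12 hp).add (isBdd_C21 hp))).mul
    (isBdd_const _)).add ((isBdd_const _).mul (isBdd_E2 hp)))
  have hG3 : IsBdd (G3 p) := (((isBdd_const _).mul (isBdd_C22 hp)).mul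
    (isBdd_const _)).add ((isBdd_const _).mul (isBdd_E3 hp))
  refine ⟨fun α => (b * (4 * α ^ 2 * (normTime p α * normVel p α)) + 1) *
      (2 * (p + 1) * α ^ (1 - p) * normTime p α ^ 2),
    fun α => 2 * (p + 1) * α ^ (1 - p) * normTime p α ^ 2,
    fun α => if hα : 0 < α then (isPotential hp hα).solution else 0, ?_, ?_, ?_, ?_, ?_, ?_,
    C11_frequently_pos hp, C11_frequently_neg hp⟩
  · intro α hα
    have h0 := (isPotential hp hα).isUniqueSolutionPair (b := 0) le_rfl
    have h1 := (isPotential hp hα).isUniqueSolutionPair hb.le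
    rw [timeMap_eq_normTime hp hα] at h0 h1
    rw [energy_eq_normVel hp hα] at h1
    rw [zero_mul, zero_add, one_mul] at h0
    simp only [dif_pos hα]
    exact ⟨h0, h1, by rw [energy_eq_normVel hp hα]⟩
  · intro _
    refine ⟨fun α => α ^ (2 * (1 - p)) * t α, fun α => α ^ (2 * (1 - p)) * h α,
      ht.mul_isLittleO (Eventually.of_forall fun _ => rfl),
      hh.mul_isLittleO (Eventually.of_forall fun _ => rfl), ?_⟩
    filter_upwards [hα0] with α hα
    rw [hform α hα, hTM α hα, hT α hα, rpow_neg_eq hα, rpow_neg_add_one_eq hα,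
      rpow_two_mul_eq hα]
    ring
  · rintro rfl
    have hw : ∀ α : ℝ, 0 < α → α ^ (-2 : ℝ) = α⁻¹ ^ 2 := fun α hα => by
      rw [rpow_neg hα.le, rpow_two, inv_pow]
    -- For `p = 2` the powers `α^{-p}` and `α^{2(1-p)}` coincide, and the `C22` and `G3` terms are
    -- of order `α^{-3}`. Subtracting `C3` offsets its explicit appearance in the first brace.
    refine ⟨fun α => α ^ (-2 : ℝ) * (t α - C3 2 α + α⁻¹ * (1 / 2 * C22 2 α)),
      fun α => α ^ (-2 : ℝ) * (h α + α⁻¹ * G3 2 α),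
      ((ht.sub (isNull_C3 hp)).add (hinv.mul_isBdd ((isBdd_const _).mul
        (isBdd_C22 hp)))).mul_isLittleO (Eventually.of_forall fun _ => rfl),
      (hh.add (hinv.mul_isBdd hG3)).mul_isLittleO (Eventually.of_forall fun _ => rfl), ?_⟩
    filter_upwards [hα0] with α hα
    rw [hform α hα, hTM α hα, hT α hα, show (1 : ℝ) - 2 = -1 by norm_num, hw α hα,
      rpow_neg_one]
    ring
  · intro hp2
    have hx : IsNull fun α => α ^ (p - 2) := isNull_rpow (by linarith)
    -- The left side is `α^{-p}`; for `p < 2` it is `α^{2(1-p)}` times a null factor and goes into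
    -- the error.
    have hy : ∀ α : ℝ, 0 < α → α ^ (1 - p) * α⁻¹ = (α ^ (1 - p)) ^ 2 * α ^ (p - 2) := by
      intro α hα
      rw [← rpow_two, ← rpow_mul hα.le, ← rpow_add hα, ← rpow_neg_one α, ← rpow_add hα]
      congr 1
      ring
    refine ⟨fun α => α ^ (2 * (1 - p)) * (t α + α ^ (p - 2) *
        (1 / 2 * (C12 p α + C21 p α) + 1 / 2 * C22 p α * α⁻¹)),
      fun α => α ^ (2 * (1 - p)) * (h α + α ^ (p - 2) * (G2 p α + G3 p α * α⁻¹)),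
      (ht.add (hx.mul_isBdd (((isBdd_const _).mul ((isBdd_C12 hp).add (isBdd_C21 hp))).add
        (((isBdd_const _).mul (isBdd_C22 hp)).mul hinv.isBdd)))).mul_isLittleO
        (Eventually.of_forall fun _ => rfl),
      (hh.add (hx.mul_isBdd (hG2.add (hG3.mul hinv.isBdd)))).mul_isLittleO
        (Eventually.of_forall fun _ => rfl), ?_⟩
    filter_upwards [hα0] with α hα
    have e1 : normTime p α = C0 p + (C1 p + 1 / 2 * C11 p α) * α ^ (1 - p) +
        C2 p * α ^ (2 * (1 - p)) + α ^ (2 * (1 - p)) * (t α + α ^ (p - 2) *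
        (1 / 2 * (C12 p α + C21 p α) + 1 / 2 * C22 p α * α⁻¹)) := by
      rw [hT α hα, rpow_two_mul_eq hα]
      linear_combination
        (1 / 2 * (C12 p α + C21 p α) + 1 / 2 * C22 p α * α⁻¹) * hy α hα
    have e2 : normTime p α * normVel p α = G0 p + G1 p α * α ^ (1 - p) +
        G4 p α * α ^ (2 * (1 - p)) +
        α ^ (2 * (1 - p)) * (h α + α ^ (p - 2) * (G2 p α + G3 p α * α⁻¹)) := by
      rw [hTM α hα, rpow_two_mul_eq hα]
      linear_combination (G2 p α + G3 p α * α⁻¹) * hy α hα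
    rw [hform α hα, ← e1, ← e2]
  · have := C0_pos hp
    have := G0_pos hp
    have : 0 < p + 1 := by linarith
    positivity
  · have hx : IsNull fun α => α ^ (1 - p) := isNull_rpow (by linarith)
    have hC22 := isBdd_C22 hp
    have hC11 := isBdd_C11 hp
    have hC12 := (isBdd_C12 hp).add (isBdd_C21 hp)
    have hTlim : Tendsto (normTime p) atTop (𝓝 (C0 p)) := by
      have h1 : IsNull fun α => α ^ (1 - p) * ((C1 p + 1 / 2 * C11 p α +
          1 / 2 * (C12 p α + C21 p α) * α⁻¹ + 1 / 2 * C22 p α * α⁻¹ ^ 2) +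
          α ^ (1 - p) * (C2 p + t α)) := by
        refine hx.mul_isBdd (IsBdd.add (((((isBdd_const _).add ((isBdd_const _).mul hC11)).add
          (((isBdd_const _).mul hC12).mul hinv.isBdd)).add (((isBdd_const _).mul hC22).mul ?_)))
          (hx.isBdd.mul ((isBdd_const _).add ht.isBdd)))
        simpa only [pow_two] using hinv.isBdd.mul hinv.isBdd
      have h2 := (isNull_iff.1 h1).const_add (C0 p)
      rw [add_zero] at h2
      refine h2.congr' ?_
      filter_upwards [hα0] with α hα
      rw [hT α hα]
      ring
    have hMlim : Tendsto (normVel p) atTop (𝓝 (E0 p)) := by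
      obtain ⟨t', ht', hM⟩ := normVel_eq hp
      have h1 : IsNull fun α => α ^ (1 - p) * ((E1 p + E2 p α * α⁻¹ + E3 p α * α⁻¹ ^ 2) +
          α ^ (1 - p) * (E4 p + t' α)) := by
        refine hx.mul_isBdd (IsBdd.add (((isBdd_const _).add ((isBdd_E2 hp).mul hinv.isBdd)).add
          ((isBdd_E3 hp).mul ?_)) (hx.isBdd.mul ((isBdd_const _).add ht'.isBdd)))
        simpa only [pow_two] using hinv.isBdd.mul hinv.isBdd
      have h2 := (isNull_iff.1 h1).const_add (E0 p)
      rw [add_zero] at h2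
      refine h2.congr' ?_
      filter_upwards [hα0] with α hα
      rw [hM α hα]
      ring
    -- Dividing by `α^{3-p} = α^{1-p} α²` turns the `+ 1` of the last factor into `α^{-2}`, which
    -- vanishes in the limit.
    have hlim := ((hTlim.pow 2).const_mul (2 * (p + 1))).mul
      (((hTlim.mul hMlim).const_mul (4 * b)).add ((isNull_iff.1 hinv).pow 2))
    have hval : 2 * (p + 1) * C0 p ^ 2 * (4 * b * (C0 p * E0 p) + 0 ^ 2) =
        8 * b * (p + 1) * C0 p ^ 2 * G0 p := by
      rw [G0]
      ring
    rw [hval] at hlim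
    refine hlim.congr' ?_
    filter_upwards [hα0] with α hα
    have h3 : α ^ (3 - p) = α ^ (1 - p) * α ^ 2 := by
      rw [show 3 - p = 1 - p + 2 by ring, rpow_add hα, rpow_two]
    have h4 : 0 < α ^ (1 - p) := rpow_pos_of_pos hα _
    rw [h3]
    field_simp
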